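/- Let $n\ge 0$, $[n]=\{1,\dots,n\}$, and let $\mathcal P$ be the set of pairs $(X,Y)$ with $X\subsetneq Y\subseteq[n]$. A polymatroid on $[n]$ is a non-negative, monotone, submodular function $h:2^{[n]}\to\mathbb R$ with $h(\emptyset)=0$; write $h(Y|X)=h(Y)-h(X)$, and $\langle v,h\rangle=\sum_{(X,Y)\in\mathcal P}v_{Y|X}\,h(Y|X)$ for a vector $v$ indexed by $\mathcal P$. Let $\mathsf{DC}$ be a set of degree constraints, i.e. triples $(X,Y,N_{Y|X})$ with $(X,Y)\in\mathcal P$ and $N_{Y|X}\in\mathbb N\cup\{\infty\}$, and let $n_{Y|X}=\log_2 N_{Y|X}$, where $n_{Y|X}=\infty$ if $\mathsf{DC}$ has no constraint for $(X,Y)$, and the smallest bound is used if it has several. Let $\mathcal B\subseteq 2^{[n]}$ be a set of targets, and let $$\mathsf{OBJ}=\sup_h\ \min_{B\in\mathcal B}h(B),$$ where $h$ ranges over the polymatroids on $[n]$ with $h(Y)-h(X)\le n_{Y|X}$ for all $(X,Y)\in\mathcal P$. For $\lambda,\delta\in\mathbb Q_{\ge0}^{\mathcal P}$ with $\lambda_{Y|X}=0$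 whenever $X\ne\emptyset$, the inequality $\langle\lambda,h\rangle\le\langle\delta,h\rangle$ is a Shannon flow inequality if it holds for all polymatroids $h$ on $[n]$. Let $e_{Y|X}$ be the unit vectors of $\mathbb Q^{\mathcal P}$, and put $e_{\emptyset|\emptyset}=0$. The proof steps are the vectors - $s_{I,J}=e_{I\cup J|J}-e_{I|I\cap J}$ for $I\not\subseteq J$, $J\not\subseteq I$, - $m_{X,Y}=e_{X|\emptyset}-e_{Y|\emptyset}$ for $X\subsetneq Y$, - $c_{X,Y}=e_{Y|\emptyset}-e_{Y|X}-e_{X|\emptyset}$ for $X\subsetneq Y$, - $d_{Y,X}=e_{Y|X}+e_{X|\emptyset}-e_{Y|\emptyset}$ for $X\subsetneq Y$. A proof sequence of length $\ell$ for the inequality consists of proof steps $f_1,\dots,f_\ell$ and rational weights $w_1,\dots,w_\ell>0$ such that the vectors $\delta_0=\delta$, $\delta_i=\delta_{i-1}+w_if_i$ are all entrywise non-negative, and $\delta_\ell\ge\lambda$ entrywise. **Statement.** There is an absolute constant $C$ such that, for all $n$, $\mathsf{DC}$ and $\mathcal B$ as above with $0<\mathsf{OBJ}<\infty$, there is a Shannon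 flow inequality $\langle\lambda,h\rangle\le\langle\delta,h\rangle$ with $\lambda,\delta\in\mathbb Q_{\ge0}^{\mathcal P}$ satisfying: - $\|\lambda\|_1=1$; - $\sum_{(X,Y)\in\mathcal P}\delta_{Y|X}\,n_{Y|X}\le\mathsf{OBJ}$ (with $0\cdot\infty=0$, so $\delta$ vanishes on unconstrained pairs); - $\lambda_{Y|X}=0$ for all $(X,Y)\in\mathcal P$ with $X\neq\emptyset$ or $Y\notin\mathcal B$; - the inequality has a proof sequence of length at most $C\cdot n^4\cdot 2^{7n}\cdot 3^n$; in particular, the length is polynomial in $2^n$. -/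

import Mathlib

namespace ShannonFlow

/-- The index set of all pairs `(X, Y)` with `X ⊂ Y ⊆ [n]` (strict inclusion); `[n]` is `Fin n`. -/
abbrev Pair (n : ℕ) : Type :=
  {p : Finset (Fin n) × Finset (Fin n) // p.1 ⊂ p.2}

/-- The smaller set `X` of a pair `(X, Y)`. -/
def Pair.lower {n : ℕ} (p : Pair n) : Finset (Fin n) := p.1.1

/-- The larger set `Y` of a pair `(X, Y)`. -/
def Pair.upper {n : ℕ} (p : Pair n) : Finset (Fin n) := p.1.2

/-- `h` is a polymatroid on `[n]`: a non-negative monotone submodular set function with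
`h ∅ = 0`. -/
structure IsPolymatroid {n : ℕ} (h : Finset (Fin n) → ℝ) : Prop where
  empty : h ∅ = 0
  nonneg : ∀ X, 0 ≤ h X
  mono : ∀ X Y, X ⊆ Y → h X ≤ h Y
  submodular : ∀ X Y, h (X ∪ Y) + h (X ∩ Y) ≤ h X + h Y

/-- The conditional polymatroid `h(Y|X) = h(Y) - h(X)`, indexed by pairs. -/
def cond {n : ℕ} (h : Finset (Fin n) → ℝ) (p : Pair n) : ℝ := h p.upper - h p.lower

/-- A degree constraint `(X, Y, N)` with `X ⊂ Y ⊆ [n]` and `N ∈ ℕ ∪ {∞}`. -/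
structure DegreeConstraint (n : ℕ) where
  pair : Pair n
  bound : ℕ∞

open Classical in
/-- `log₂ N` for `N ∈ ℕ ∪ {∞}`, with `log₂ 0 = -∞` and `log₂ ∞ = ∞`. -/
noncomputable def log2 (N : ℕ∞) : EReal :=
  if N = ⊤ then ⊤
  else if N = 0 then ⊥
  else ((Real.logb 2 (N.toNat : ℝ) : ℝ) : EReal)

/-- `h` satisfies all the degree constraints: `h(Y) - h(X) ≤ log₂ N` for every
`(X, Y, N) ∈ DC`. -/
def SatisfiesDC {n : ℕ} (DC : Set (DegreeConstraint n)) (h : Finset (Fin n) → ℝ) : Prop :=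
  ∀ c ∈ DC, ((cond h c.pair : ℝ) : EReal) ≤ log2 c.bound

/-- The log-degree bound `n_{Y|X} = log₂ N_{Y|X}` that `DC` puts on the pair `(X, Y)`. It is `∞`
when `DC` does not constrain the pair, and the smallest bound counts if `DC` has several for the
same pair. -/
noncomputable def logDegree {n : ℕ} (DC : Set (DegreeConstraint n)) (p : Pair n) : EReal :=
  ⨅ c ∈ DC, ⨅ _ : c.pair = p, log2 c.bound

/-- The optimal value of the problem: maximize `min_{B ∈ targets} h(B)` over all polymatroids `h`
on `[n]` that satisfy the degree constraints, as an extended real. -/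
noncomputable def objective {n : ℕ} (DC : Set (DegreeConstraint n))
    (targets : Set (Finset (Fin n))) : EReal :=
  ⨆ h ∈ {h : Finset (Fin n) → ℝ | IsPolymatroid h ∧ SatisfiesDC DC h},
    ⨅ B ∈ targets, ((h B : ℝ) : EReal)

/-- `⟨v, h⟩ = ∑_{(X, Y)} v_{Y|X} h(Y|X)`. -/
noncomputable def pairing {n : ℕ} (v : Pair n → ℚ≥0) (h : Finset (Fin n) → ℝ) : ℝ :=
  ∑ p : Pair n, (v p : ℝ) * cond h p

/-- `⟨lam, h⟩ ≤ ⟨delta, h⟩` is a Shannon flow inequality: the left-hand side is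
`∑_B lam_B h(B)`, that is, only entries `lam_{B|∅}` may be non-zero, and the inequality holds
for all polymatroids on `[n]`. -/
def IsShannonFlow {n : ℕ} (lam delta : Pair n → ℚ≥0) : Prop :=
  (∀ p : Pair n, p.lower ≠ ∅ → lam p = 0) ∧
    ∀ h : Finset (Fin n) → ℝ, IsPolymatroid h → pairing lam h ≤ pairing delta h

/-- The coefficient vector of `h(Y|X)`. It is the zero vector if `X = Y`, in accordance with
`h(∅|∅) = 0`. -/
def single {n : ℕ} (X Y : Finset (Fin n)) : Pair n → ℚ :=
  fun p => if p.lower = X ∧ p.upper = Y then 1 else 0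

/-- The four kinds of proof steps. -/
inductive ProofStep (n : ℕ) : Type
  /-- submodularity, for incomparable `I` and `J`: `h(I ∪ J|J) - h(I|I ∩ J) ≤ 0` -/
  | submodularity (I J : Finset (Fin n)) (hIJ : ¬ I ⊆ J) (hJI : ¬ J ⊆ I) : ProofStep n
  /-- monotonicity, for `X ⊂ Y`: `-h(Y|∅) + h(X|∅) ≤ 0` -/
  | monotonicity (X Y : Finset (Fin n)) (hXY : X ⊂ Y) : ProofStep n
  /-- composition, for `X ⊂ Y`: `h(Y|∅) - h(Y|X) - h(X|∅) ≤ 0` -/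
  | composition (X Y : Finset (Fin n)) (hXY : X ⊂ Y) : ProofStep n
  /-- decomposition, for `X ⊂ Y`: `-h(Y|∅) + h(Y|X) + h(X|∅) ≤ 0` -/
  | decomposition (Y X : Finset (Fin n)) (hXY : X ⊂ Y) : ProofStep n

/-- The coefficient vector of a proof step. -/
def ProofStep.vec {n : ℕ} : ProofStep n → Pair n → ℚ
  | .submodularity I J _ _ => single J (I ∪ J) - single (I ∩ J) I
  | .monotonicity X Y _ => single ∅ X - single ∅ Y
  | .composition X Y _ => single ∅ Y - single X Y - single ∅ X
  | .decomposition Y X _ => single X Y + single ∅ X - single ∅ Y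

/-- The vector reached from `delta` by adding the weighted proof steps of a list. -/
def applySteps {n : ℕ} (delta : Pair n → ℚ≥0) (steps : List (ℚ × ProofStep n)) : Pair n → ℚ :=
  fun p => (delta p : ℚ) + (steps.map fun s => s.1 * s.2.vec p).sum

/-- `steps = (w₁ f₁, …, w_ℓ f_ℓ)` is a proof sequence, of length `ℓ`, for
`⟨lam, h⟩ ≤ ⟨delta, h⟩`: all weights are positive, all the vectors `delta₀ = delta`,
`delta_i = delta_{i-1} + w_i f_i` are non-negative, and `delta_ℓ ≥ lam` entrywise. -/
def IsProofSequence {n : ℕ} (lam delta : Pair n → ℚ≥0) (steps : List (ℚ × ProofStep n)) : Prop :=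
  (∀ s ∈ steps, 0 < s.1) ∧
  (∀ i ≤ steps.length, ∀ p : Pair n, 0 ≤ applySteps delta (steps.take i) p) ∧
  ∀ p : Pair n, (lam p : ℚ) ≤ applySteps delta steps p

end ShannonFlow

/-! By linear programming duality the objective is certified by vectors `δ`, `lam` for which `⟨δ, h⟩
- ⟨lam, h⟩` is a non-negative combination, a witness, of submodularities and monotonicities
(`exists_dual_solution`). The programs have at most `2 ^ n + 1` rows and entries of size at most 2,
so Cramer's rule gives basic solutions a common denominator `2 ^ O(n * 2 ^ n)`. After scaling,
everything is integral, and the witness can be taken with least total submodularity weight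
(`IsWitness.exists_isMinWitness`).

The proof sequence is built in rounds that move large chunks (`exists_round`). Let `Λ` be the
remaining demand and `k = ⌈Λ / (3 * 4 ^ n)⌉`. Let `A` be a maximal family of sets at which `k` units
can be collected by compositions and decompositions (`exists_collecting_family`). Evaluating the
witness identity at the indicator of the complement of `A` shows that some demanded set in `A` wants
at least `k` units, or some submodularity from `I, J ∈ A` to `I ∪ J ∉ A` has weight at least `k`
(`exists_large_coefficient`). In the first case `k` units are delivered; in the second that
submodularity is applied with weight `k` and removed from the witness. All these steps are lossless,
so the rest is still a minimal witness.

A minimal witness has submodularity weight at most `n ^ 2 * 4 ^ n * Λ`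
(`IsMinWitness.submodWeight_le`). Hence the potential `n ^ 2 * 4 ^ n * Λ + submodWeight x` shrinks
by a fixed factor `1 - Ω(1 / (n ^ 2 * 16 ^ n))` per round, and the number of rounds is governed by
its initial logarithm, which is `O(n * 2 ^ n)` (`exists_reaches`). A round takes at most `2 ^ n + 2`
steps. -/

namespace ShannonFlow

open Matrix

/-! ### Farkas' lemma -/

/-- **Farkas' lemma** for linear functionals: a functional that is non-negative wherever finitely
many functionals are non-negative is a non-negative combination of them. -/
theorem exists_nonneg_combination {V κ : Type*} [AddCommGroup V] [Module ℝ V] [DecidableEq κ]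
    (s : Finset κ) (a : κ → V →ₗ[ℝ] ℝ) (b : V →ₗ[ℝ] ℝ)
    (h : ∀ x, (∀ j ∈ s, 0 ≤ a j x) → 0 ≤ b x) :
    ∃ c : κ → ℝ, (∀ j, 0 ≤ c j) ∧ b = ∑ j ∈ s, c j • a j := by
  induction s using Finset.induction_on generalizing a b with
  | empty =>
    refine ⟨0, fun _ => le_rfl, ?_⟩
    ext x
    have h1 := h x (by simp)
    have h2 := h (-x) (by simp)
    simp only [map_neg] at h2
    simp only [Finset.sum_empty, LinearMap.zero_apply]
    linarith
  | insert m s hm ih =>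
    by_cases hb : ∀ x, (∀ j ∈ s, 0 ≤ a j x) → 0 ≤ b x
    · obtain ⟨c, hc, rfl⟩ := ih a b hb
      refine ⟨Function.update c m 0, fun j => ?_, ?_⟩
      · by_cases hj : j = m
        · simp [hj]
        · simp [hj, hc j]
      · rw [Finset.sum_insert hm]
        simp only [Function.update_self, zero_smul, zero_add]
        refine Finset.sum_congr rfl fun j hj => ?_
        rw [Function.update_of_ne (ne_of_mem_of_not_mem hj hm)]
    · push Not at hb
      obtain ⟨x₁, hx₁, hbx₁⟩ := hb
      have ham : a m x₁ < 0 := by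
        by_contra! hcon
        refine absurd (h x₁ fun j hj => ?_) (not_le.2 hbx₁)
        rcases Finset.mem_insert.1 hj with rfl | hj
        · exact hcon
        · exact hx₁ j hj
      obtain ⟨x₀, hx₀, hbx₀, hmx₀⟩ : ∃ x₀, (∀ j ∈ s, 0 ≤ a j x₀) ∧ b x₀ < 0 ∧ a m x₀ = -1 := by
        have hpos : 0 < (-(a m x₁))⁻¹ := by
          apply inv_pos.2; linarith
        refine ⟨(-(a m x₁))⁻¹ • x₁, fun j hj => ?_, ?_, ?_⟩
        · rw [map_smul, smul_eq_mul]
          exact mul_nonneg hpos.le (hx₁ j hj)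
        · rw [map_smul, smul_eq_mul]
          exact mul_neg_of_pos_of_neg hpos hbx₁
        · rw [map_smul, smul_eq_mul]
          rw [inv_neg, neg_mul, inv_mul_cancel₀ ham.ne]
      -- All functionals are composed with the projection `x ↦ x + a m x • x₀` onto the kernel of `a
      -- m`; there the constraint `m` is vacuous and only `s` is left.
      obtain ⟨c, hc, hbc⟩ := ih (fun j => a j + a j x₀ • a m) (b + b x₀ • a m) (by
        intro x hx
        have h1 := h (x + a m x • x₀) (by
          intro j hj
          rcases Finset.mem_insert.1 hj with rfl | hj
          · simp [hmx₀]
          · have h2 := hx j hj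
            simp only [LinearMap.add_apply, LinearMap.smul_apply, smul_eq_mul] at h2
            simp only [map_add, map_smul, smul_eq_mul]
            linarith)
        simp only [map_add, map_smul, smul_eq_mul] at h1
        simp only [LinearMap.add_apply, LinearMap.smul_apply, smul_eq_mul]
        linarith)
      refine ⟨Function.update c m (-b x₀ + ∑ j ∈ s, c j * a j x₀), fun j => ?_, ?_⟩
      · by_cases hj : j = m
        · subst hj
          rw [Function.update_self]
          have := Finset.sum_nonneg fun i hi => mul_nonneg (hc i) (hx₀ i hi)
          linarith
        · simp [hj, hc j]
      · rw [Finset.sum_insert hm, Function.update_self]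
        have h3 : ∑ j ∈ s, Function.update c m (-b x₀ + ∑ j ∈ s, c j * a j x₀) j • a j
            = ∑ j ∈ s, c j • a j := by
          refine Finset.sum_congr rfl fun j hj => ?_
          rw [Function.update_of_ne (ne_of_mem_of_not_mem hj hm)]
        rw [h3]
        ext x
        have h4 := congrArg (fun f : V →ₗ[ℝ] ℝ => f x) hbc
        simp only [LinearMap.add_apply, LinearMap.smul_apply, smul_eq_mul, LinearMap.sum_apply,
          mul_add, Finset.sum_add_distrib] at h4
        simp only [LinearMap.add_apply, LinearMap.smul_apply, smul_eq_mul, LinearMap.sum_apply,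
          add_mul, Finset.sum_mul]
        have h5 : ∑ j ∈ s, c j * (a j x₀ * a m x) = ∑ j ∈ s, c j * a j x₀ * a m x :=
          Finset.sum_congr rfl fun j _ => by ring
        linarith

/-! ### Linear programs: basic solutions and their denominators -/

section LinearProgramming

variable {ι κ : Type*} [Fintype κ]

/-- Farkas' lemma for `A x = b`, `x ≥ 0` together with a bound on a linear cost. -/
theorem exists_nonneg_solution_cost_le [Fintype ι] (A : Matrix ι κ ℝ) (b : ι → ℝ) (c : κ → ℝ) (γ : ℝ)
    (h : ∀ (y : ι → ℝ) (s : ℝ), 0 ≤ s → (∀ j, 0 ≤ (∑ i, y i * A i j) + s * c j) →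
      0 ≤ (∑ i, y i * b i) + s * γ) :
    ∃ x : κ → ℝ, 0 ≤ x ∧ A *ᵥ x = b ∧ c ⬝ᵥ x ≤ γ := by
  classical
  let col (v : ι → ℝ) (r : ℝ) : (ι → ℝ) × ℝ →ₗ[ℝ] ℝ :=
    (∑ i, v i • LinearMap.proj i) ∘ₗ LinearMap.fst ℝ _ _ + r • LinearMap.snd ℝ _ _
  have hcol (v r y s) : col v r (y, s) = (∑ i, y i * v i) + s * r := by
    simp [col, mul_comm]
  -- The index `none` carries the constraint `0 ≤ s`; its coefficient becomes the slack in the cost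
  -- bound.
  obtain ⟨x, hx, hb⟩ := exists_nonneg_combination Finset.univ
    (fun j : Option κ => j.elim (col 0 1) fun j => col (fun i => A i j) (c j)) (col b γ) (by
      rintro ⟨y, s⟩ hy
      rw [hcol]
      refine h y s ?_ fun j => ?_
      · simpa [hcol] using hy none (Finset.mem_univ _)
      · simpa [hcol] using hy (some j) (Finset.mem_univ _))
  refine ⟨fun j => x (some j), fun j => hx _, ?_, ?_⟩
  · ext i
    have := congrArg (fun f : (ι → ℝ) × ℝ →ₗ[ℝ] ℝ => f (Pi.single i 1, 0)) hb
    simp only [LinearMap.sum_apply, LinearMap.add_apply, LinearMap.smul_apply, Fintype.sum_option,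
      Option.elim, hcol, smul_eq_mul, Pi.single_apply, ite_mul, one_mul, zero_mul,
      Finset.sum_ite_eq', Finset.mem_univ, if_true, add_zero, Pi.zero_apply, mul_zero] at this
    simp [this, mulVec, dotProduct, mul_comm]
  · have := congrArg (fun f : (ι → ℝ) × ℝ →ₗ[ℝ] ℝ => f (0, 1)) hb
    simp only [LinearMap.sum_apply, LinearMap.add_apply, LinearMap.smul_apply, Fintype.sum_option,
      Option.elim, hcol, smul_eq_mul, Pi.zero_apply, zero_mul, Finset.sum_const_zero, one_mul,
      zero_add, mul_one] at this
    rw [this, dotProduct]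
    have h0 := hx none
    have h1 : ∑ j, c j * x (some j) = ∑ j, x (some j) * c j :=
      Finset.sum_congr rfl fun j _ => mul_comm _ _
    linarith

/-- `y` is a non-negative solution of `A y = b` whose support selects independent columns. -/
def IsBasic (A : Matrix ι κ ℝ) (b : ι → ℝ) (y : κ → ℝ) : Prop :=
  0 ≤ y ∧ A *ᵥ y = b ∧ ∀ d : κ → ℝ, A *ᵥ d = 0 → (∀ j, y j = 0 → d j = 0) → d = 0

/-- While the columns in the support are dependent, move along a kernel direction of non-increasing
cost until a coordinate vanishes; the support shrinks. Since `c ≥ 0`, a direction of negative cost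
has a negative coordinate, so the motion does stop. -/
theorem exists_isBasic_le (A : Matrix ι κ ℝ) (b : ι → ℝ) (c : κ → ℝ) (hc : 0 ≤ c) (x : κ → ℝ)
    (hx : 0 ≤ x) (hAx : A *ᵥ x = b) : ∃ y, IsBasic A b y ∧ c ⬝ᵥ y ≤ c ⬝ᵥ x := by
  classical
  induction hN : (Finset.univ.filter fun j => x j ≠ 0).card using Nat.strong_induction_on
    generalizing x with
  | _ N ih =>
    by_cases hbas : ∀ d : κ → ℝ, A *ᵥ d = 0 → (∀ j, x j = 0 → d j = 0) → d = 0
    · exact ⟨x, ⟨hx, hAx, hbas⟩, le_rfl⟩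
    push Not at hbas
    obtain ⟨d₀, hd₀, hsupp₀, hne₀⟩ := hbas
    obtain ⟨d, hd, hsupp, hcd, j₁, hj₁⟩ : ∃ d : κ → ℝ, A *ᵥ d = 0 ∧ (∀ j, x j = 0 → d j = 0) ∧
        c ⬝ᵥ d ≤ 0 ∧ ∃ j, d j < 0 := by
      have key : ∀ d : κ → ℝ, c ⬝ᵥ d < 0 → ∃ j, d j < 0 := by
        intro d hd
        by_contra! hcon
        exact absurd (dotProduct_nonneg_of_nonneg hc (show 0 ≤ d from hcon)) (not_le.2 hd)
      have hneg : A *ᵥ (-d₀) = 0 := by rw [mulVec_neg, hd₀, neg_zero]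
      have hsn : ∀ j, x j = 0 → (-d₀) j = 0 := fun j hj => by simp [hsupp₀ j hj]
      rcases lt_trichotomy (c ⬝ᵥ d₀) 0 with hlt | heq | hgt
      · exact ⟨d₀, hd₀, hsupp₀, hlt.le, key _ hlt⟩
      · obtain ⟨j, hj⟩ := Function.ne_iff.1 hne₀
        rcases lt_or_gt_of_ne hj with hj | hj
        · exact ⟨d₀, hd₀, hsupp₀, heq.le, j, hj⟩
        · exact ⟨-d₀, hneg, hsn, by simp [heq], j, by simpa using hj⟩
      · have : c ⬝ᵥ (-d₀) < 0 := by simpa using hgt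
        exact ⟨-d₀, hneg, hsn, this.le, key _ this⟩
    obtain ⟨j₀, hj₀, hmin⟩ := Finset.exists_min_image (Finset.univ.filter fun j => d j < 0)
      (fun j => x j / (-d j)) ⟨j₁, by simpa using hj₁⟩
    simp only [Finset.mem_filter, Finset.mem_univ, true_and] at hj₀ hmin
    set t := x j₀ / (-d j₀) with ht
    have ht0 : 0 ≤ t := div_nonneg (hx j₀) (by linarith)
    have hz0 : x j₀ + t * d j₀ = 0 := by
      rw [ht]; field_simp [hj₀.ne]; ring
    have hle : c ⬝ᵥ (x + t • d) ≤ c ⬝ᵥ x := by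
      rw [dotProduct_add, dotProduct_smul, smul_eq_mul]
      nlinarith
    obtain ⟨y, hy, hyx⟩ := ih _ (by
      rw [← hN]
      apply Finset.card_lt_card
      rw [Finset.ssubset_iff_of_subset]
      · refine ⟨j₀, ?_, ?_⟩
        · simp only [Finset.mem_filter, Finset.mem_univ, true_and]
          exact fun h0 => hj₀.ne (hsupp _ h0)
        · simpa using hz0
      · intro j
        simp only [Finset.mem_filter, Finset.mem_univ, true_and]
        intro hj h0
        exact hj (by simp [h0, hsupp j h0])) (x + t • d) (by
      intro j
      show 0 ≤ x j + t * d j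
      by_cases hj : d j < 0
      · have h1 := hmin j hj
        rw [le_div_iff₀ (by linarith)] at h1
        linarith
      · exact add_nonneg (hx j) (mul_nonneg ht0 (not_lt.1 hj))) (by
      rw [mulVec_add, mulVec_smul, hd, smul_zero, add_zero, hAx]) rfl
    exact ⟨y, hy, hyx.trans hle⟩

/-- A basic solution is determined by its zero set: two with the same zeros differ by a kernel
vector supported on independent columns. -/
theorem finite_setOf_isBasic (A : Matrix ι κ ℝ) (b : ι → ℝ) : {y | IsBasic A b y}.Finite := by
  refine Set.Finite.of_injOn (f := fun y => {j | y j = 0}) (t := Set.univ)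
    (fun _ _ => Set.mem_univ _) ?_ Set.finite_univ
  rintro y hy z hz hyz
  have := hy.2.2 (y - z) (by rw [mulVec_sub, hy.2.1, hz.2.1, sub_self]) (by
    intro j hj
    have : z j = 0 := (Set.ext_iff.1 hyz j).1 hj
    simp only [Pi.sub_apply, hj, this, sub_self])
  exact sub_eq_zero.1 this

/-- A common denominator of a basic solution of an integral system, by Cramer's rule for the Gram
matrix of the selected columns. -/
theorem IsBasic.exists_denominator [Fintype ι] (A : Matrix ι κ ℤ) (b : ι → ℤ) (K : ℕ)
    (hK : ∀ i j, |A i j| ≤ K) {y : κ → ℝ}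
    (hy : IsBasic (A.map (Int.cast : ℤ → ℝ)) (fun i => (b i : ℝ)) y) :
    ∃ D : ℕ, 0 < D ∧
      (∃ r ≤ Fintype.card ι, D ≤ r.factorial * (Fintype.card ι * K ^ 2) ^ r) ∧
      ∃ z : κ → ℕ, ∀ j, (z j : ℝ) = D * y j := by
  classical
  let s := {j // y j ≠ 0}
  let As : Matrix ι s ℤ := A.submatrix id Subtype.val
  let AR : Matrix ι s ℝ := As.map (Int.cast : ℤ → ℝ)
  let G : Matrix s s ℤ := Asᵀ * As
  have hext : ∀ w : s → ℝ, (A.map (Int.cast : ℤ → ℝ)) *ᵥ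
      (fun j => if hj : y j ≠ 0 then w ⟨j, hj⟩ else 0) = AR *ᵥ w := by
    intro w
    ext i
    simp only [mulVec, dotProduct]
    rw [← Fintype.sum_subtype_add_sum_subtype (fun j => y j ≠ 0), add_eq_left.2]
    · exact Finset.sum_congr rfl fun j _ => by simp [AR, As, j.2]
    · exact Finset.sum_eq_zero fun j _ => by rw [dif_neg j.2, mul_zero]
  have hinj : ∀ w : s → ℝ, AR *ᵥ w = 0 → w = 0 := by
    intro w hw
    have := hy.2.2 _ ((hext w).trans hw) fun j hj => dif_neg (not_not.2 hj)
    ext j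
    simpa [j.2] using congrFun this j.1
  have hGR : G.map (Int.cast : ℤ → ℝ) = ARᵀ * AR := by
    ext i j
    simp [G, AR, mul_apply]
  have hdetR : (G.map (Int.cast : ℤ → ℝ)).det ≠ 0 := by
    intro h0
    obtain ⟨w, hw0, hw⟩ := exists_mulVec_eq_zero_iff.2 h0
    refine hw0 (hinj w ?_)
    rw [hGR, ← mulVec_mulVec] at hw
    have := congrArg (fun u => w ⬝ᵥ u) hw
    rw [dotProduct_zero, dotProduct_mulVec, vecMul_transpose] at this
    exact dotProduct_self_eq_zero.1 this
  have hcast : (G.map (Int.cast : ℤ → ℝ)).det = (G.det : ℝ) :=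
    ((Int.castRingHom ℝ).map_det G).symm
  have hdet : G.det ≠ 0 := by
    intro h0
    rw [hcast, h0] at hdetR
    simp at hdetR
  -- Independent columns are at most as many as the rows, so the determinant bound does not involve
  -- the much larger number of columns.
  have hcard : Fintype.card s ≤ Fintype.card ι := by
    have := LinearMap.finrank_le_finrank_of_injective (f := AR.mulVecLin) (by
      rw [← LinearMap.ker_eq_bot, LinearMap.ker_eq_bot']
      exact hinj)
    simpa using this
  let v : s → ℤ := G.adjugate *ᵥ (Asᵀ *ᵥ b)
  have hv : ∀ j : s, (v j : ℝ) = G.det * y j.1 := by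
    have h1 : AR *ᵥ (fun j : s => y j.1) = fun i => (b i : ℝ) := by
      rw [← hext, ← hy.2.1]
      congr 1
      ext j
      by_cases hj : y j = 0 <;> simp [hj]
    have h2 : (G.map (Int.cast : ℤ → ℝ)) *ᵥ (fun j : s => y j.1) = ARᵀ *ᵥ fun i => (b i : ℝ) := by
      rw [hGR, ← mulVec_mulVec, h1]
    have h3 := congrArg (fun u => (G.map (Int.cast : ℤ → ℝ)).adjugate *ᵥ u) h2
    simp only [mulVec_mulVec, adjugate_mul] at h3
    intro j
    have h4 := congrFun h3 j
    rw [smul_mulVec, one_mulVec, Pi.smul_apply, smul_eq_mul, hcast, ← mulVec_mulVec] at h4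
    rw [h4]
    have h5 : (G.map (Int.cast : ℤ → ℝ)).adjugate = G.adjugate.map (Int.cast : ℤ → ℝ) :=
      ((Int.castRingHom ℝ).map_adjugate G).symm
    rw [h5]
    simp only [v, mulVec, dotProduct, AR, Int.cast_sum, Int.cast_mul, map_apply, transpose_apply]
  refine ⟨G.det.natAbs, Int.natAbs_pos.2 hdet, ⟨Fintype.card s, hcard, ?_⟩,
    fun j => if hj : y j ≠ 0 then (v ⟨j, hj⟩).natAbs else 0, fun j => ?_⟩
  · have hG : ∀ i j, AbsoluteValue.abs (G i j) ≤ (Fintype.card ι * K ^ 2 : ℤ) := by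
      intro i j
      simp only [G, mul_apply, AbsoluteValue.abs_apply]
      refine (Finset.abs_sum_le_sum_abs _ _).trans ?_
      refine (Finset.sum_le_card_nsmul _ _ ((K : ℤ) ^ 2) fun l _ => ?_).trans (by simp)
      rw [abs_mul, sq]
      exact mul_le_mul (hK _ _) (hK _ _) (abs_nonneg _) (Int.natCast_nonneg _)
    have := det_le hG
    rw [AbsoluteValue.abs_apply, Int.abs_eq_natAbs, nsmul_eq_mul] at this
    exact_mod_cast this
  · by_cases hj : y j = 0
    · simp [hj]
    · have h1 := hv ⟨j, hj⟩
      beta_reduce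
      rw [dif_pos hj, Nat.cast_natAbs, Nat.cast_natAbs, Int.cast_abs, Int.cast_abs, h1, abs_mul,
        abs_of_nonneg (hy.1 j)]

/-- A feasible integral linear program with non-negative costs has an optimal solution with a
common denominator that depends on the number of rows and the size of the entries only. -/
theorem exists_optimal_solution_denominator [Fintype ι] (A : Matrix ι κ ℤ) (b : ι → ℤ) (K : ℕ)
    (hK : ∀ i j, |A i j| ≤ K) (c : κ → ℝ) (hc : 0 ≤ c)
    (hfeas : ∃ x : κ → ℝ, 0 ≤ x ∧ A.map (Int.cast : ℤ → ℝ) *ᵥ x = fun i => (b i : ℝ)) :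
    ∃ D : ℕ, 0 < D ∧
      (∃ r ≤ Fintype.card ι, D ≤ r.factorial * (Fintype.card ι * K ^ 2) ^ r) ∧
      ∃ z : κ → ℕ, A.map (Int.cast : ℤ → ℝ) *ᵥ (fun j => (z j : ℝ)) = (fun i => (D * b i : ℝ)) ∧
        ∀ x : κ → ℝ, 0 ≤ x → A.map (Int.cast : ℤ → ℝ) *ᵥ x = (fun i => (b i : ℝ)) →
          c ⬝ᵥ (fun j => (z j : ℝ)) ≤ D * (c ⬝ᵥ x) := by
  obtain ⟨x₀, hx₀, hAx₀⟩ := hfeas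
  obtain ⟨y₀, hy₀, -⟩ := exists_isBasic_le _ _ c hc x₀ hx₀ hAx₀
  -- The best of the finitely many basic solutions is optimal, since every feasible point is
  -- dominated by a basic one.
  obtain ⟨y, hy, hmin⟩ := Set.exists_min_image _ (fun y => c ⬝ᵥ y)
    (finite_setOf_isBasic (A.map (Int.cast : ℤ → ℝ)) (fun i => (b i : ℝ))) ⟨y₀, hy₀⟩
  obtain ⟨D, hD, hDle, z, hz⟩ := IsBasic.exists_denominator A b K hK hy
  have hzy : (fun j => (z j : ℝ)) = (D : ℝ) • y := funext hz
  refine ⟨D, hD, hDle, z, ?_, fun x hx hAx => ?_⟩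
  · rw [hzy, mulVec_smul, hy.2.1]
    rfl
  · obtain ⟨y', hy', hle⟩ := exists_isBasic_le _ _ c hc x hx hAx
    rw [hzy, dotProduct_smul, smul_eq_mul]
    exact mul_le_mul_of_nonneg_left ((hmin y' hy').trans hle) (Nat.cast_nonneg D)

end LinearProgramming

/-! ### Witnesses as solutions of an integral linear system -/

variable {n : ℕ}

/-- The submodularity defect of `h` at `I`, `J`. -/
def defect (h : Finset (Fin n) → ℝ) (I J : Finset (Fin n)) : ℝ :=
  h I + h J - h (I ∪ J) - h (I ∩ J)

/-- `⟨δ, h⟩ - ∑_Z lam_Z h(Z)`. -/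
def balance (δ : Pair n → ℤ) (lam : Finset (Fin n) → ℤ) (h : Finset (Fin n) → ℝ) : ℝ :=
  ∑ p, (δ p : ℝ) * cond h p - ∑ Z, (lam Z : ℝ) * h Z

/-- Index set of the elementary inequalities: submodularity for `inl (I, J)` and monotonicity
`h X ≤ h (X ∪ Y)` for `inr (X, Y)`. -/
abbrev Elem (n : ℕ) : Type :=
  (Finset (Fin n) × Finset (Fin n)) ⊕ (Finset (Fin n) × Finset (Fin n))

/-- The values of all elementary inequalities at `h`. -/
def elemValue (h : Finset (Fin n) → ℝ) : Elem n → ℝ :=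
  Sum.elim (fun q => defect h q.1 q.2) (fun q => h (q.1 ∪ q.2) - h q.1)

/-- `x` writes `⟨δ, h⟩ - ⟨lam, h⟩` as a non-negative combination of elementary inequalities. -/
def IsWitness (δ : Pair n → ℤ) (lam : Finset (Fin n) → ℤ) (x : Elem n → ℝ) : Prop :=
  0 ≤ x ∧ ∀ h : Finset (Fin n) → ℝ, h ∅ = 0 → elemValue h ⬝ᵥ x = balance δ lam h

/-- The total weight of the submodularities in `x`. -/
def submodWeight {R : Type*} [AddCommMonoid R] (x : Elem n → R) : R := ∑ q, x (Sum.inl q)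

/-- An integral witness with the least submodularity weight among all real witnesses. -/
def IsMinWitness (δ : Pair n → ℤ) (lam : Finset (Fin n) → ℤ) (x : Elem n → ℤ) : Prop :=
  IsWitness δ lam (fun j => (x j : ℝ)) ∧
    ∀ y, IsWitness δ lam y → ((submodWeight x : ℤ) : ℝ) ≤ submodWeight y

/-- The coordinate vector of `Z`, which is zero for `Z = ∅`. -/
def unitVec (Z W : Finset (Fin n)) : ℤ := if Z = ∅ then 0 else if W = Z then 1 else 0

/-- The row `∅` is always zero, so any vector of Farkas multipliers can be read as a set function
normalised at `∅`. -/
theorem sum_mul_unitVec (y : Finset (Fin n) → ℝ) (Z : Finset (Fin n)) :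
    ∑ W, y W * (unitVec Z W : ℝ) = Function.update y ∅ 0 Z := by
  by_cases hZ : Z = ∅
  · simp [unitVec, hZ]
  · simp [unitVec, hZ]

/-- The coefficient vectors of the elementary inequalities. -/
def elemMatrix (n : ℕ) : Matrix (Finset (Fin n)) (Elem n) ℤ := fun W =>
  Sum.elim (fun q => unitVec q.1 W + unitVec q.2 W - unitVec (q.1 ∪ q.2) W - unitVec (q.1 ∩ q.2) W)
    (fun q => unitVec (q.1 ∪ q.2) W - unitVec q.1 W)

/-- The coefficient vector of `balance δ lam`. -/
def balanceVec (δ : Pair n → ℤ) (lam : Finset (Fin n) → ℤ) (W : Finset (Fin n)) : ℤ :=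
  ∑ p, δ p * (unitVec p.upper W - unitVec p.lower W) - ∑ Z, lam Z * unitVec Z W

theorem sum_mul_elemMatrix (y : Finset (Fin n) → ℝ) (j : Elem n) :
    ∑ W, y W * (elemMatrix n W j : ℝ) = elemValue (Function.update y ∅ 0) j := by
  rcases j with q | q
  · simp only [elemMatrix, Sum.elim_inl, Int.cast_add, Int.cast_sub, mul_add, mul_sub,
      Finset.sum_add_distrib, Finset.sum_sub_distrib, sum_mul_unitVec, elemValue, defect]
  · simp only [elemMatrix, Sum.elim_inr, Int.cast_sub, mul_sub, Finset.sum_sub_distrib,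
      sum_mul_unitVec, elemValue]

theorem sum_mul_balanceVec (δ : Pair n → ℤ) (lam : Finset (Fin n) → ℤ)
    (y : Finset (Fin n) → ℝ) :
    ∑ W, y W * (balanceVec δ lam W : ℝ) = balance δ lam (Function.update y ∅ 0) := by
  have key : ∀ {α : Type} [Fintype α] (c : α → ℝ) (Z : α → Finset (Fin n)),
      ∑ W, y W * ∑ a, c a * (unitVec (Z a) W : ℝ) = ∑ a, c a * Function.update y ∅ 0 (Z a) := by
    intro α _ c Z
    simp only [← sum_mul_unitVec, Finset.mul_sum]
    rw [Finset.sum_comm]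
    exact Finset.sum_congr rfl fun a _ => Finset.sum_congr rfl fun W _ => by ring
  simp only [balanceVec, Int.cast_sub, Int.cast_sum, Int.cast_mul, mul_sub,
    Finset.sum_sub_distrib, balance, cond]
  rw [key (fun p => (δ p : ℝ)) Pair.upper, key (fun p => (δ p : ℝ)) Pair.lower,
    key (fun Z => (lam Z : ℝ)) fun Z => Z]

theorem unitVec_nonneg_and_le_one (Z W : Finset (Fin n)) : 0 ≤ unitVec Z W ∧ unitVec Z W ≤ 1 := by
  unfold unitVec; split_ifs <;> simp

theorem abs_elemMatrix_le (W : Finset (Fin n)) (j : Elem n) : |elemMatrix n W j| ≤ 2 := by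
  rcases j with ⟨I, J⟩ | ⟨I, J⟩ <;>
  · have h1 := unitVec_nonneg_and_le_one I W
    have h2 := unitVec_nonneg_and_le_one J W
    have h3 := unitVec_nonneg_and_le_one (I ∪ J) W
    have h4 := unitVec_nonneg_and_le_one (I ∩ J) W
    simp only [elemMatrix, Sum.elim_inl, Sum.elim_inr]
    rw [abs_le]
    constructor <;> linarith

theorem update_empty {h : Finset (Fin n) → ℝ} (h0 : h ∅ = 0) : Function.update h ∅ 0 = h := by
  rw [← h0, Function.update_eq_self]

/-- Both sides of the witness identity are linear in `h`, so testing at the coordinate functions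
suffices. This makes witnesses the feasible points of a linear program. -/
theorem isWitness_iff (δ : Pair n → ℤ) (lam : Finset (Fin n) → ℤ) (x : Elem n → ℝ) :
    IsWitness δ lam x ↔ 0 ≤ x ∧
      (elemMatrix n).map (Int.cast : ℤ → ℝ) *ᵥ x = fun W => (balanceVec δ lam W : ℝ) := by
  refine and_congr_right fun _ => ⟨fun H => ?_, fun H h h0 => ?_⟩
  · ext Z
    have h1 := H (Function.update (Pi.single Z 1) ∅ 0) (by simp)
    rw [← sum_mul_balanceVec] at h1
    simp only [dotProduct, ← sum_mul_elemMatrix] at h1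
    simpa [Pi.single_apply, mulVec, dotProduct] using h1
  · rw [← update_empty h0, ← sum_mul_balanceVec]
    simp only [dotProduct, ← sum_mul_elemMatrix, Finset.sum_mul]
    rw [Finset.sum_comm]
    refine Finset.sum_congr rfl fun W _ => ?_
    have := congrFun H W
    simp only [mulVec, dotProduct, map_apply] at this
    rw [← this, Finset.mul_sum]
    exact Finset.sum_congr rfl fun j _ => by ring

theorem elemValue_nonneg {h : Finset (Fin n) → ℝ} (hh : IsPolymatroid h) : 0 ≤ elemValue h := by
  rintro (q | q)
  · have := hh.submodular q.1 q.2
    simp only [elemValue, Sum.elim_inl, defect, Pi.zero_apply]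
    linarith
  · have := hh.mono q.1 (q.1 ∪ q.2) Finset.subset_union_left
    simpa [elemValue] using this

theorem IsWitness.balance_nonneg {δ : Pair n → ℤ} {lam : Finset (Fin n) → ℤ} {x : Elem n → ℝ}
    (hx : IsWitness δ lam x) {h : Finset (Fin n) → ℝ} (hh : IsPolymatroid h) :
    0 ≤ balance δ lam h := by
  rw [← hx.2 h hh.empty]
  exact dotProduct_nonneg_of_nonneg (elemValue_nonneg hh) hx.1

theorem cond_nonneg {h : Finset (Fin n) → ℝ} (hh : ∀ X Y, X ⊆ Y → h X ≤ h Y) (p : Pair n) :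
    0 ≤ cond h p :=
  sub_nonneg.2 (hh _ _ p.2.1)

/-! ### Capping the coefficients of a valid inequality -/

/-- The largest polymatroid below `h` for which `Y` is a flat extension of `X`. -/
theorem IsPolymatroid.quotient {h : Finset (Fin n) → ℝ} (hh : IsPolymatroid h)
    (X Y : Finset (Fin n)) :
    IsPolymatroid fun W => min (h W) (h (W ∪ Y) - (h Y - h X)) where
  empty := by
    have := hh.nonneg X
    simp [hh.empty, this]
  nonneg W := by
    have h1 := hh.mono Y (W ∪ Y) Finset.subset_union_right
    have h2 := hh.nonneg X
    exact le_min (hh.nonneg W) (by linarith)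
  mono V W hVW := by
    have h1 := hh.mono _ _ hVW
    have h2 := hh.mono _ _ (Finset.union_subset_union_left (t := Y) hVW)
    exact min_le_min h1 (by linarith)
  submodular V W := by
    have mixed : ∀ A B : Finset (Fin n),
        min (h (A ∪ B)) (h (A ∪ B ∪ Y) - (h Y - h X)) +
          min (h (A ∩ B)) (h (A ∩ B ∪ Y) - (h Y - h X)) ≤ h A + (h (B ∪ Y) - (h Y - h X)) := by
      intro A B
      have h1 := hh.submodular A (B ∪ Y)
      rw [← Finset.union_assoc] at h1
      have h2 := hh.mono (A ∩ B) (A ∩ (B ∪ Y))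
        (Finset.inter_subset_inter_left Finset.subset_union_left)
      have h3 := min_le_right (h (A ∪ B)) (h (A ∪ B ∪ Y) - (h Y - h X))
      have h4 := min_le_left (h (A ∩ B)) (h (A ∩ B ∪ Y) - (h Y - h X))
      linarith
    rcases min_choice (h V) (h (V ∪ Y) - (h Y - h X)) with hV | hV <;>
    rcases min_choice (h W) (h (W ∪ Y) - (h Y - h X)) with hW | hW <;>
    rw [hV, hW]
    · have h1 := hh.submodular V W
      have h3 := min_le_left (h (V ∪ W)) (h (V ∪ W ∪ Y) - (h Y - h X))
      have h4 := min_le_left (h (V ∩ W)) (h (V ∩ W ∪ Y) - (h Y - h X))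
      linarith
    · exact mixed V W
    · have := mixed W V
      rw [Finset.union_comm W V, Finset.inter_comm W V] at this
      linarith
    · have h1 := hh.submodular (V ∪ Y) (W ∪ Y)
      rw [← Finset.inter_union_distrib_right, ← Finset.union_union_distrib_right] at h1
      have h3 := min_le_right (h (V ∪ W)) (h (V ∪ W ∪ Y) - (h Y - h X))
      have h4 := min_le_right (h (V ∩ W)) (h (V ∩ W ∪ Y) - (h Y - h X))
      linarith

/-- In an inequality that holds for all polymatroids, a coefficient on the larger side never needs
to exceed the total weight of the smaller side. -/
theorem balance_nonneg_update_min {δ : Pair n → ℤ} {lam : Finset (Fin n) → ℤ} (hδ : 0 ≤ δ)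
    (hlam : 0 ≤ lam) (hval : ∀ h, IsPolymatroid h → 0 ≤ balance δ lam h) (p : Pair n)
    {h : Finset (Fin n) → ℝ} (hh : IsPolymatroid h) :
    0 ≤ balance (Function.update δ p (min (δ p) (∑ Z, lam Z))) lam h := by
  rcases le_total (δ p) (∑ Z, lam Z) with hle | hle
  · rw [min_eq_left hle, Function.update_eq_self]
    exact hval h hh
  rw [min_eq_right hle]
  set c := h p.upper - h p.lower with hc
  have hc0 : 0 ≤ c := cond_nonneg hh.mono p
  have hXY : p.lower ⊆ p.upper := p.2.1
  -- In the quotient `h'` the pair `p` has value zero, so `δ p` drops out, while no `h Z` falls by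
  -- more than `c = h(p)`. The loss on the smaller side is at most `(∑ Z, lam Z) * c`, which a
  -- coefficient `∑ Z, lam Z` at `p` pays for.
  have hq := hh.quotient p.lower p.upper
  have h1 := hval _ hq
  set h' : Finset (Fin n) → ℝ := fun W => min (h W) (h (W ∪ p.upper) - (h p.upper - h p.lower))
    with hh'
  have hp : cond h' p = 0 := by
    have e1 : h' p.upper = h p.lower := by
      simp only [hh', Finset.union_self]
      rw [min_eq_right (by linarith)]; ring
    have e2 : h' p.lower = h p.lower := by
      simp only [hh', Finset.union_eq_right.2 hXY]
      rw [min_eq_left (by linarith)]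
    rw [cond, e1, e2, sub_self]
  have hle' : ∀ q : Pair n, cond h' q ≤ cond h q := by
    intro q
    have hsub : q.lower ⊆ q.upper := q.2.1
    simp only [cond]
    have a1 : h' q.upper ≤ h q.upper := min_le_left _ _
    have a2 : h' q.upper ≤ h (q.upper ∪ p.upper) - c := min_le_right _ _
    rcases min_choice (h q.lower) (h (q.lower ∪ p.upper) - c) with e | e
    · have : h' q.lower = h q.lower := e
      linarith
    · have e' : h' q.lower = h (q.lower ∪ p.upper) - c := e
      have h2 := hh.submodular q.upper (q.lower ∪ p.upper)
      rw [← Finset.union_assoc, Finset.union_eq_left.2 hsub] at h2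
      have h3 := hh.mono q.lower (q.upper ∩ (q.lower ∪ p.upper))
        (Finset.subset_inter hsub Finset.subset_union_left)
      linarith
  have hge : ∀ Z, h Z - c ≤ h' Z := by
    intro Z
    have := hh.mono Z (Z ∪ p.upper) Finset.subset_union_left
    exact le_min (by linarith) (by linarith)
  have hlamsum : ∑ Z, (lam Z : ℝ) * h Z - (∑ Z, (lam Z : ℝ)) * c ≤ ∑ Z, (lam Z : ℝ) * h' Z := by
    rw [Finset.sum_mul, ← Finset.sum_sub_distrib]
    refine Finset.sum_le_sum fun Z _ => ?_
    rw [← mul_sub]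
    exact mul_le_mul_of_nonneg_left (hge Z) (by exact_mod_cast hlam Z)
  have hδsum : ∑ q, (δ q : ℝ) * cond h' q + (∑ Z, (lam Z : ℝ)) * c ≤
      ∑ q, ((Function.update δ p (∑ Z, lam Z) q : ℤ) : ℝ) * cond h q := by
    rw [← Finset.add_sum_erase _ _ (Finset.mem_univ p),
      ← Finset.add_sum_erase (a := p) _ (fun q => ((Function.update δ p _ q : ℤ) : ℝ) * cond h q)
        (Finset.mem_univ p), hp]
    rw [Function.update_self]
    have : ∑ q ∈ Finset.univ.erase p, (δ q : ℝ) * cond h' q ≤ ∑ q ∈ Finset.univ.erase p,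
        ((Function.update δ p (∑ Z, lam Z) q : ℤ) : ℝ) * cond h q := by
      refine Finset.sum_le_sum fun q hq => ?_
      rw [Function.update_of_ne (Finset.ne_of_mem_erase hq)]
      exact mul_le_mul_of_nonneg_left (hle' q) (by exact_mod_cast hδ q)
    have e : cond h p = c := rfl
    push_cast
    rw [e]
    linarith
  unfold balance at h1 ⊢
  linarith

/-- Pairs are capped one at a time: the inequality stays valid and the cap `∑ Z, lam Z` does not
change. -/
theorem balance_nonneg_min {δ : Pair n → ℤ} {lam : Finset (Fin n) → ℤ} (hδ : 0 ≤ δ)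
    (hlam : 0 ≤ lam) (hval : ∀ h, IsPolymatroid h → 0 ≤ balance δ lam h)
    {h : Finset (Fin n) → ℝ} (hh : IsPolymatroid h) :
    0 ≤ balance (fun p => min (δ p) (∑ Z, lam Z)) lam h := by
  classical
  have key : ∀ s : Finset (Pair n), ∀ h, IsPolymatroid h →
      0 ≤ balance (fun p => if p ∈ s then min (δ p) (∑ Z, lam Z) else δ p) lam h := by
    intro s
    induction s using Finset.induction_on with
    | empty => simpa using hval
    | insert p s hp ih =>
      intro h hh
      have hnn : (0 : Pair n → ℤ) ≤ fun p => if p ∈ s then min (δ p) (∑ Z, lam Z) else δ p := by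
        intro q
        have h1 : 0 ≤ ∑ Z, lam Z := Finset.sum_nonneg fun Z _ => hlam Z
        have h2 := hδ q
        simp only [Pi.zero_apply] at h2 ⊢
        split_ifs
        · exact le_min h2 h1
        · exact h2
      convert balance_nonneg_update_min hnn hlam ih p hh using 2
      ext q
      by_cases hq : q = p
      · subst hq; simp [hp]
      · simp [hq]
  simpa using key Finset.univ h hh

/-! ### The submodularity weight of a minimal witness -/

/-- A strictly submodular polymatroid. -/
def strictFun (n : ℕ) (Z : Finset (Fin n)) : ℝ := Z.card * (2 * n - Z.card)

theorem card_le_n (Z : Finset (Fin n)) : (Z.card : ℝ) ≤ n := by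
  exact_mod_cast (Finset.card_le_univ Z).trans (by simp)

theorem strictFun_mono {X Y : Finset (Fin n)} (h : X ⊆ Y) : strictFun n X ≤ strictFun n Y := by
  have h1 : (X.card : ℝ) ≤ Y.card := by exact_mod_cast Finset.card_le_card h
  have h2 := card_le_n Y
  unfold strictFun
  nlinarith

theorem strictFun_nonneg (X : Finset (Fin n)) : 0 ≤ strictFun n X := by
  simpa [strictFun] using strictFun_mono (Finset.empty_subset X)

theorem strictFun_le (X : Finset (Fin n)) : strictFun n X ≤ (n : ℝ) ^ 2 := by
  have h2 := card_le_n X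
  unfold strictFun
  nlinarith [sq_nonneg ((n : ℝ) - X.card)]

/-- The defect is exactly `2 * |I \ J| * |J \ I|`. -/
theorem one_le_defect_strictFun {I J : Finset (Fin n)} (hIJ : ¬ I ⊆ J) (hJI : ¬ J ⊆ I) :
    1 ≤ defect (strictFun n) I J := by
  have h1 : ((I ∪ J).card : ℝ) + (I ∩ J).card = I.card + J.card := by
    exact_mod_cast Finset.card_union_add_card_inter I J
  have h2 : ((I ∩ J).card : ℝ) + 1 ≤ I.card := by
    exact_mod_cast Finset.card_lt_card ⟨Finset.inter_subset_left, fun h =>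
      hIJ (h.trans Finset.inter_subset_right)⟩
  have h3 : ((I ∩ J).card : ℝ) + 1 ≤ J.card := by
    exact_mod_cast Finset.card_lt_card ⟨Finset.inter_subset_right, fun h =>
      hJI (h.trans Finset.inter_subset_left)⟩
  unfold defect strictFun
  have h4 : ((I ∪ J).card : ℝ) = I.card + J.card - (I ∩ J).card := by linarith
  rw [h4]
  nlinarith

/-- Comparable sets have defect zero, and at incomparable ones the strict function has defect at
least 1, enough to repair a violation of size `s`. -/
theorem isPolymatroid_add_strictFun {h : Finset (Fin n) → ℝ} {s : ℝ} (hs : 0 ≤ s) (h0 : h ∅ = 0)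
    (hmono : ∀ X Y, X ⊆ Y → h X ≤ h Y) (hsub : ∀ I J, 0 ≤ defect h I J + s) :
    IsPolymatroid fun Z => h Z + s * strictFun n Z := by
  have hm : ∀ X Y : Finset (Fin n), X ⊆ Y →
      h X + s * strictFun n X ≤ h Y + s * strictFun n Y := fun X Y hXY =>
    add_le_add (hmono X Y hXY) (mul_le_mul_of_nonneg_left (strictFun_mono hXY) hs)
  refine ⟨by simp [h0, strictFun], fun X => ?_, hm, fun X Y => ?_⟩
  · have := hm ∅ X (Finset.empty_subset X)
    simpa [h0, strictFun] using this
  · by_cases hXY : X ⊆ Y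
    · rw [Finset.union_eq_right.2 hXY, Finset.inter_eq_left.2 hXY, add_comm]
    by_cases hYX : Y ⊆ X
    · rw [Finset.union_eq_left.2 hYX, Finset.inter_eq_right.2 hYX]
    have h1 := mul_le_mul_of_nonneg_left (one_le_defect_strictFun hXY hYX) hs
    have h2 := hsub X Y
    unfold defect at h1 h2
    linarith

theorem card_pair_le : Fintype.card (Pair n) ≤ 4 ^ n := by
  refine (Fintype.card_subtype_le _).trans ?_
  simp [← mul_pow]

/-- The submodularity weight of a minimal witness is at most a constant times the weight of the
smaller side. -/
theorem IsMinWitness.submodWeight_le {δ : Pair n → ℤ} {lam : Finset (Fin n) → ℤ} {x : Elem n → ℤ}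
    (hx : IsMinWitness δ lam x) (hδ : 0 ≤ δ) (hlam : 0 ≤ lam) :
    submodWeight x ≤ n ^ 2 * 4 ^ n * ∑ Z, lam Z := by
  have hΛ : 0 ≤ ∑ Z, lam Z := Finset.sum_nonneg fun Z _ => hlam Z
  -- By minimality any real witness of this weight will do. Only submodularities have a cost, so a
  -- Farkas multiplier is a monotone `h` that violates submodularity by at most `s`.
  obtain ⟨y, hy0, hy, hyc⟩ := exists_nonneg_solution_cost_le
    ((elemMatrix n).map (Int.cast : ℤ → ℝ)) (fun W => (balanceVec δ lam W : ℝ))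
    (Sum.elim (fun _ => 1) (fun _ => 0)) ((n : ℝ) ^ 2 * 4 ^ n * ∑ Z, (lam Z : ℝ)) (by
      intro y s hs hy
      simp only [map_apply, sum_mul_elemMatrix] at hy
      rw [sum_mul_balanceVec]
      set h := Function.update y ∅ 0 with hh
      have h0 : h ∅ = 0 := by simp [hh]
      have hmono : ∀ X Y, X ⊆ Y → h X ≤ h Y := by
        intro X Y hXY
        have := hy (Sum.inr (X, Y))
        simp only [elemValue, Sum.elim_inr, Finset.union_eq_right.2 hXY, mul_zero, add_zero] at this
        linarith
      have hpoly := isPolymatroid_add_strictFun hs h0 hmono fun I J => by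
        simpa [elemValue] using hy (Sum.inl (I, J))
      -- The capped inequality is used because the correction `s * strictFun n` then costs at most
      -- `s * n ^ 2 * ∑ Z, lam Z` per pair, however large `δ` is.
      have h1 := balance_nonneg_min hδ hlam (fun h hh => hx.1.balance_nonneg hh) hpoly
      have h2 : ∑ p : Pair n, ((min (δ p) (∑ Z, lam Z) : ℤ) : ℝ) *
          cond (fun Z => h Z + s * strictFun n Z) p ≤ ∑ p, (δ p : ℝ) * cond h p +
            s * ((n : ℝ) ^ 2 * 4 ^ n * ∑ Z, (lam Z : ℝ)) := by
        have h3 : ∀ p : Pair n, ((min (δ p) (∑ Z, lam Z) : ℤ) : ℝ) *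
            cond (fun Z => h Z + s * strictFun n Z) p ≤ (δ p : ℝ) * cond h p +
              s * ((n : ℝ) ^ 2 * ∑ Z, (lam Z : ℝ)) := by
          intro p
          have e : cond (fun Z => h Z + s * strictFun n Z) p = cond h p +
              s * cond (strictFun n) p := by simp only [cond]; ring
          have g1 : cond (strictFun n) p ≤ (n : ℝ) ^ 2 := by
            have := strictFun_le p.upper
            have := strictFun_nonneg p.lower
            simp only [cond]; linarith
          have g0 : 0 ≤ cond (strictFun n) p := cond_nonneg (fun _ _ => strictFun_mono) p
          have a1 : ((min (δ p) (∑ Z, lam Z) : ℤ) : ℝ) ≤ δ p := by exact_mod_cast min_le_left _ _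
          have a2 : ((min (δ p) (∑ Z, lam Z) : ℤ) : ℝ) ≤ ∑ Z, (lam Z : ℝ) := by
            exact_mod_cast min_le_right _ _
          have a3 : (0 : ℝ) ≤ ∑ Z, (lam Z : ℝ) := by exact_mod_cast hΛ
          rw [e, mul_add]
          refine add_le_add (mul_le_mul_of_nonneg_right a1 (cond_nonneg hmono p)) ?_
          calc _ ≤ (∑ Z, (lam Z : ℝ)) * (s * cond (strictFun n) p) :=
                mul_le_mul_of_nonneg_right a2 (mul_nonneg hs g0)
            _ ≤ (∑ Z, (lam Z : ℝ)) * (s * (n : ℝ) ^ 2) :=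
                mul_le_mul_of_nonneg_left (mul_le_mul_of_nonneg_left g1 hs) a3
            _ = _ := by ring
        refine (Finset.sum_le_sum fun p _ => h3 p).trans ?_
        rw [Finset.sum_add_distrib, Finset.sum_const, nsmul_eq_mul, Finset.card_univ]
        have h4 : (Fintype.card (Pair n) : ℝ) ≤ 4 ^ n := by exact_mod_cast card_pair_le
        have h5 : (0 : ℝ) ≤ s * ((n : ℝ) ^ 2 * ∑ Z, (lam Z : ℝ)) := by
          have : (0 : ℝ) ≤ ∑ Z, (lam Z : ℝ) := by exact_mod_cast hΛ
          positivity
        have := mul_le_mul_of_nonneg_right h4 h5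
        linarith
      have h6 : ∑ Z, (lam Z : ℝ) * h Z ≤ ∑ Z, (lam Z : ℝ) * (h Z + s * strictFun n Z) := by
        refine Finset.sum_le_sum fun Z _ => mul_le_mul_of_nonneg_left ?_ (by exact_mod_cast hlam Z)
        have := mul_nonneg hs (strictFun_nonneg Z)
        linarith
      unfold balance at h1 ⊢
      linarith)
  have h7 := hx.2 y ((isWitness_iff _ _ _).2 ⟨hy0, hy⟩)
  have h8 : submodWeight y ≤ (n : ℝ) ^ 2 * 4 ^ n * ∑ Z, (lam Z : ℝ) := by
    simpa [dotProduct, submodWeight] using hyc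
  exact_mod_cast h7.trans h8

/-! ### Proof sequences with integral weights -/

/-- The integral version of `single`. -/
def singleInt (X Y : Finset (Fin n)) : Pair n → ℤ :=
  fun p => if p.lower = X ∧ p.upper = Y then 1 else 0

/-- The integral version of `ProofStep.vec`. -/
def ProofStep.vecInt : ProofStep n → Pair n → ℤ
  | .submodularity I J _ _ => singleInt J (I ∪ J) - singleInt (I ∩ J) I
  | .monotonicity X Y _ => singleInt ∅ X - singleInt ∅ Y
  | .composition X Y _ => singleInt ∅ Y - singleInt X Y - singleInt ∅ X
  | .decomposition Y X _ => singleInt X Y + singleInt ∅ X - singleInt ∅ Y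

theorem ProofStep.cast_vecInt (f : ProofStep n) (p : Pair n) : ((f.vecInt p : ℤ) : ℚ) = f.vec p := by
  have h : ∀ X Y : Finset (Fin n), ((singleInt X Y p : ℤ) : ℚ) = single X Y p := fun X Y => by
    simp [singleInt, single]
  cases f <;> simp [vecInt, vec, h]

theorem singleInt_nonneg (X Y : Finset (Fin n)) : 0 ≤ singleInt X Y := by
  intro p
  unfold singleInt
  split_ifs <;> simp

/-- `δ'` can be reached from `δ` by `l` proof steps with integral weights. -/
inductive Reaches (δ : Pair n → ℤ) : (Pair n → ℤ) → ℕ → Prop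
  | refl (hδ : 0 ≤ δ) : Reaches δ δ 0
  | snoc {δ' : Pair n → ℤ} {l : ℕ} (k : ℤ) (f : ProofStep n) (hk : 0 < k)
      (h : Reaches δ δ' l) (h0 : 0 ≤ δ' + k • f.vecInt) : Reaches δ (δ' + k • f.vecInt) (l + 1)

theorem Reaches.trans {a b c : Pair n → ℤ} {l m : ℕ} (h₁ : Reaches a b l) (h₂ : Reaches b c m) :
    Reaches a c (l + m) := by
  induction h₂ with
  | refl => exact h₁
  | snoc k f hk _ h0 ih => exact ih.snoc k f hk h0

/-- Units already delivered can thus be set aside while the later rounds run. -/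
theorem Reaches.add_right {a b : Pair n → ℤ} {l : ℕ} (h : Reaches a b l) {ρ : Pair n → ℤ}
    (hρ : 0 ≤ ρ) : Reaches (a + ρ) (b + ρ) l := by
  induction h with
  | refl hδ => exact .refl (add_nonneg hδ hρ)
  | snoc k f hk _ h0 ih =>
    rw [add_right_comm]
    refine ih.snoc k f hk ?_
    rw [add_right_comm]
    exact add_nonneg h0 hρ

/-- Dividing all weights by the common denominator `D` returns to the rational setting. -/
theorem Reaches.exists_steps {a b : Pair n → ℤ} {l : ℕ} (h : Reaches a b l) {D : ℚ} (hD : 0 < D) :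
    ∃ steps : List (ℚ × ProofStep n), steps.length = l ∧ (∀ s ∈ steps, 0 < s.1) ∧
      (∀ i ≤ steps.length, ∀ p : Pair n,
        0 ≤ (a p : ℚ) / D + ((steps.take i).map fun s => s.1 * s.2.vec p).sum) ∧
      ∀ p : Pair n, (a p : ℚ) / D + (steps.map fun s => s.1 * s.2.vec p).sum = b p / D := by
  induction h with
  | refl hδ =>
    refine ⟨[], rfl, by simp, fun i _ p => ?_, by simp⟩
    have : (0 : ℚ) ≤ a p := by exact_mod_cast hδ p
    simpa using div_nonneg this hD.le
  | @snoc b l k f hk _ h0 ih =>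
    obtain ⟨steps, hlen, hpos, hnn, hfin⟩ := ih
    have hkD : 0 < (k : ℚ) / D := div_pos (by exact_mod_cast hk) hD
    have hfin' : ∀ p : Pair n, (a p : ℚ) / D +
        ((steps ++ [((k : ℚ) / D, f)]).map fun s => s.1 * s.2.vec p).sum =
          ((b + k • f.vecInt) p : ℤ) / D := by
      intro p
      rw [List.map_append, List.sum_append, ← add_assoc, hfin]
      simp only [List.map_cons, List.map_nil, List.sum_cons, List.sum_nil, add_zero, Pi.add_apply,
        Pi.smul_apply, smul_eq_mul, Int.cast_add, Int.cast_mul, f.cast_vecInt]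
      ring
    refine ⟨steps ++ [((k : ℚ) / D, f)], by simp [hlen], ?_, fun i hi p => ?_, hfin'⟩
    · intro s hs
      rcases List.mem_append.1 hs with hs | hs
      · exact hpos s hs
      · rw [List.mem_singleton.1 hs]; exact hkD
    · rcases Nat.lt_or_ge steps.length i with hlt | hle
      · rw [List.take_of_length_le (by simpa using hlt), hfin']
        have : (0 : ℚ) ≤ ((b + k • f.vecInt) p : ℤ) := by exact_mod_cast h0 p
        exact div_nonneg this hD.le
      · rw [List.take_append_of_le_length hle]
        exact hnn i hle p

/-- `⟨δ, h⟩`. -/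
def flowValue (δ : Pair n → ℤ) (h : Finset (Fin n) → ℝ) : ℝ := ∑ p, (δ p : ℝ) * cond h p

theorem balance_eq (δ : Pair n → ℤ) (lam : Finset (Fin n) → ℤ) (h : Finset (Fin n) → ℝ) :
    balance δ lam h = flowValue δ h - ∑ Z, (lam Z : ℝ) * h Z := rfl

theorem flowValue_add (δ δ' : Pair n → ℤ) (h : Finset (Fin n) → ℝ) :
    flowValue (δ + δ') h = flowValue δ h + flowValue δ' h := by
  simp [flowValue, add_mul, Finset.sum_add_distrib]

theorem flowValue_sub (δ δ' : Pair n → ℤ) (h : Finset (Fin n) → ℝ) :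
    flowValue (δ - δ') h = flowValue δ h - flowValue δ' h := by
  simp [flowValue, sub_mul, Finset.sum_sub_distrib]

theorem flowValue_smul (k : ℤ) (δ : Pair n → ℤ) (h : Finset (Fin n) → ℝ) :
    flowValue (k • δ) h = k * flowValue δ h := by
  simp [flowValue, Finset.mul_sum, mul_assoc]

theorem flowValue_singleInt {X Y : Finset (Fin n)} (hXY : X ⊆ Y) (h : Finset (Fin n) → ℝ) :
    flowValue (singleInt X Y) h = h Y - h X := by
  classical
  rcases hXY.eq_or_ssubset with rfl | hlt
  · rw [sub_self]
    refine Finset.sum_eq_zero fun (p : Pair n) _ => ?_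
    have : ¬ (p.lower = X ∧ p.upper = X) := fun ⟨h1, h2⟩ => p.2.ne (h1.trans h2.symm)
    simp [singleInt, this]
  · rw [flowValue, Finset.sum_eq_single (⟨(X, Y), hlt⟩ : Pair n)]
    · simp [singleInt, cond, Pair.lower, Pair.upper]
    · intro (p : Pair n) _ hp
      have : ¬ (p.lower = X ∧ p.upper = Y) := fun ⟨h1, h2⟩ =>
        hp (Subtype.ext (Prod.ext h1 h2))
      simp [singleInt, this]
    · simp

/-! ### Collecting units at a set -/

/-- By at most `#A` lossless proof steps, `k` units can be collected at `Z` without touching the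
coefficients of pairs whose upper set lies outside `A`. -/
def CanCollect (δ : Pair n → ℤ) (k : ℤ) (A : Finset (Finset (Fin n))) (Z : Finset (Fin n)) :
    Prop :=
  ∃ (δ' : Pair n → ℤ) (l : ℕ), l ≤ A.card ∧ 0 ≤ δ' ∧ Reaches δ (δ' + k • singleInt ∅ Z) l ∧
    (∀ p, p.upper ∉ A → δ p ≤ δ' p) ∧
    ∀ h : Finset (Fin n) → ℝ, h ∅ = 0 → flowValue δ' h + k * h Z = flowValue δ h

theorem CanCollect.mono {δ : Pair n → ℤ} {k : ℤ} {A A' : Finset (Finset (Fin n))}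
    {Z : Finset (Fin n)} (h : CanCollect δ k A Z) (hA : A ⊆ A') : CanCollect δ k A' Z := by
  obtain ⟨δ', l, hl, h0, hr, hp, hf⟩ := h
  exact ⟨δ', l, hl.trans (Finset.card_le_card hA), h0, hr, fun p hpA => hp p fun h => hpA (hA h),
    hf⟩

theorem sub_smul_singleInt_nonneg {δ : Pair n → ℤ} (hδ : 0 ≤ δ) {k : ℤ} (p : Pair n)
    (hp : k ≤ δ p) : 0 ≤ δ - k • singleInt p.lower p.upper := by
  intro q
  by_cases hq : q = p
  · subst hq; simp [singleInt, hp]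
  · have : ¬ (q.lower = p.lower ∧ q.upper = p.upper) := fun ⟨h1, h2⟩ =>
      hq (Subtype.ext (Prod.ext h1 h2))
    simpa [singleInt, this] using hδ q

/-- Collect at `p.lower`, then compose with `p`, whose `k` units are still intact because `p.upper ∉
A`. The extra step is paid for by the new member `p.upper`; for `p.lower = ∅` the units are already
in place. -/
theorem canCollect_up {δ : Pair n → ℤ} (hδ : 0 ≤ δ) {k : ℤ} (hk : 0 < k)
    {A : Finset (Finset (Fin n))} (hA : ∀ Z ∈ A, Z ≠ ∅ → CanCollect δ k A Z) (p : Pair n)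
    (hp : k ≤ δ p) (hlow : p.lower ∈ A) (hup : p.upper ∉ A) :
    CanCollect δ k (insert p.upper A) p.upper := by
  have hother : ∀ q : Pair n, q.upper ∉ insert p.upper A →
      singleInt p.lower p.upper q = 0 := by
    intro q hq
    have : ¬ (q.lower = p.lower ∧ q.upper = p.upper) := fun ⟨_, h2⟩ =>
      hq (h2 ▸ Finset.mem_insert_self _ _)
    simp [singleInt, this]
  by_cases hW : p.lower = ∅
  · refine ⟨δ - k • singleInt p.lower p.upper, 0, Nat.zero_le _,
      sub_smul_singleInt_nonneg hδ p hp, ?_, fun q hq => ?_, fun h h0 => ?_⟩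
    · rw [hW, sub_add_cancel]
      exact .refl hδ
    · simp [hother q hq]
    · rw [flowValue_sub, flowValue_smul, flowValue_singleInt (show p.lower ⊆ p.upper from p.2.1), hW, h0]
      ring
  · obtain ⟨δ', l, hl, h0', hr, hle, hf⟩ := hA _ hlow hW
    have hnn := sub_smul_singleInt_nonneg h0' p (hp.trans (hle p hup))
    have heq : δ' + k • singleInt ∅ p.lower +
        k • (ProofStep.composition p.lower p.upper p.2).vecInt =
          δ' - k • singleInt p.lower p.upper + k • singleInt ∅ p.upper := by
      simp only [ProofStep.vecInt, smul_sub]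
      abel
    refine ⟨δ' - k • singleInt p.lower p.upper, l + 1, ?_, hnn, ?_, fun q hq => ?_,
      fun h h0 => ?_⟩
    · rw [Finset.card_insert_of_notMem hup]
      exact Nat.succ_le_succ hl
    · rw [← heq]
      refine hr.snoc k _ hk ?_
      rw [heq]
      exact add_nonneg hnn (smul_nonneg hk.le (singleInt_nonneg _ _))
    · rw [Pi.sub_apply, Pi.smul_apply, hother q hq, smul_zero, sub_zero]
      exact hle q fun h => hq (Finset.mem_insert_of_mem h)
    · rw [flowValue_sub, flowValue_smul, flowValue_singleInt (show p.lower ⊆ p.upper from p.2.1), ← hf h h0]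
      ring

theorem reaches_decomposition {δ δ' : Pair n → ℤ} {k : ℤ} (hk : 0 < k) {l : ℕ} (h0 : 0 ≤ δ')
    {X Y : Finset (Fin n)} (hXY : X ⊂ Y) (hr : Reaches δ (δ' + k • singleInt ∅ Y) l) :
    Reaches δ (δ' + k • singleInt X Y + k • singleInt ∅ X) (l + 1) := by
  have heq : δ' + k • singleInt ∅ Y + k • (ProofStep.decomposition Y X hXY).vecInt =
      δ' + k • singleInt X Y + k • singleInt ∅ X := by
    simp only [ProofStep.vecInt, smul_sub, smul_add]
    abel
  rw [← heq]
  refine hr.snoc k _ hk ?_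
  rw [heq]
  exact add_nonneg (add_nonneg h0 (smul_nonneg hk.le (singleInt_nonneg _ _)))
    (smul_nonneg hk.le (singleInt_nonneg _ _))

/-- One decomposition at `Y`, paid for by the new member `X`. The by-product at `(X, Y)` is kept in
`δ'`, so nothing is lost. -/
theorem canCollect_down {δ : Pair n → ℤ} {k : ℤ} (hk : 0 < k)
    {A : Finset (Finset (Fin n))} {X Y : Finset (Fin n)} (hXY : X ⊂ Y)
    (hY : CanCollect δ k A Y) (hX : X ∉ A) : CanCollect δ k (insert X A) X := by
  obtain ⟨δ', l, hl, h0', hr, hle, hf⟩ := hY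
  have hs : 0 ≤ k • singleInt X Y := smul_nonneg hk.le (singleInt_nonneg _ _)
  refine ⟨δ' + k • singleInt X Y, l + 1, ?_, add_nonneg h0' hs,
    reaches_decomposition hk h0' hXY hr, fun q hq => ?_, fun h h0 => ?_⟩
  · rw [Finset.card_insert_of_notMem hX]
    exact Nat.succ_le_succ hl
  · have h1 := hle q fun h => hq (Finset.mem_insert_of_mem h)
    have h2 := hs q
    simp only [Pi.zero_apply] at h2
    rw [Pi.add_apply]
    linarith
  · rw [flowValue_add, flowValue_smul, flowValue_singleInt hXY.1, ← hf h h0]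
    ring

/-- The family of sets at which `k` units can be collected along pairs of coefficient at
least `k`. -/
theorem exists_collecting_family {δ : Pair n → ℤ} (hδ : 0 ≤ δ) {k : ℤ} (hk : 0 < k) :
    ∃ A : Finset (Finset (Fin n)), ∅ ∈ A ∧ (∀ Z ∈ A, Z ≠ ∅ → CanCollect δ k A Z) ∧
      (∀ p : Pair n, k ≤ δ p → p.lower ∈ A → p.upper ∈ A) ∧
      ∀ X Y, X ⊆ Y → Y ∈ A → X ∈ A := by
  classical
  -- A family of maximal cardinality is closed upwards along large pairs and downwards under
  -- inclusion, since otherwise it could be enlarged.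
  obtain ⟨A, hA, hmax⟩ := Finset.exists_max_image
    (Finset.univ.filter fun A : Finset (Finset (Fin n)) =>
      ∅ ∈ A ∧ ∀ Z ∈ A, Z ≠ ∅ → CanCollect δ k A Z) Finset.card
    ⟨{∅}, by simp⟩
  simp only [Finset.mem_filter, Finset.mem_univ, true_and] at hA hmax
  have hext : ∀ Z, Z ∉ A → CanCollect δ k (insert Z A) Z → False := by
    intro Z hZ hc
    have h1 := hmax (insert Z A) ⟨Finset.mem_insert_of_mem hA.1, fun W hW hW0 => by
      rcases Finset.mem_insert.1 hW with rfl | hW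
      · exact hc
      · exact (hA.2 W hW hW0).mono (Finset.subset_insert _ _)⟩
    rw [Finset.card_insert_of_notMem hZ] at h1
    omega
  refine ⟨A, hA.1, hA.2, fun p hp hlow => ?_, fun X Y hXY hY => ?_⟩
  · by_contra hup
    exact hext _ hup (canCollect_up hδ hk hA.2 p hp hlow hup)
  · by_contra hX
    have hne : X ≠ Y := fun e => hX (e ▸ hY)
    have hY0 : Y ≠ ∅ := by
      rintro rfl
      exact hne (Finset.subset_empty.1 hXY)
    exact hext _ hX (canCollect_down hk (hXY.ssubset_of_ne hne) (hA.2 Y hY hY0) hX)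

theorem card_finset_fin : Fintype.card (Finset (Fin n)) = 2 ^ n := by simp

/-! ### One round -/

/-- The cut inequality: either a demanded set or a submodularity that leads out of the
family `A` has coefficient at least `k`. -/
theorem exists_large_coefficient {δ : Pair n → ℤ} {lam : Finset (Fin n) → ℤ} {x : Elem n → ℤ}
    (hx : IsWitness δ lam fun j => (x j : ℝ)) (hlam0 : lam ∅ = 0) {k : ℤ} (hk : 0 < k)
    (hΛ : 3 * 4 ^ n * (k - 1) < ∑ Z, lam Z) {A : Finset (Finset (Fin n))} (hA0 : ∅ ∈ A)
    (hup : ∀ p : Pair n, k ≤ δ p → p.lower ∈ A → p.upper ∈ A)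
    (hdown : ∀ X Y, X ⊆ Y → Y ∈ A → X ∈ A) :
    (∃ B ∈ A, B ≠ ∅ ∧ k ≤ lam B) ∨
      ∃ I J, I ∈ A ∧ J ∈ A ∧ I ∪ J ∉ A ∧ k ≤ x (Sum.inl (I, J)) := by
  by_contra! hcon
  obtain ⟨hB, hIJ⟩ := hcon
  have hk1 : (0 : ℝ) ≤ k - 1 := by
    have : (1 : ℝ) ≤ k := by exact_mod_cast hk
    linarith
  -- This `h` is monotone, and its defect is negative, namely `-1`, only at submodularities that
  -- leave `A`. If all relevant coefficients were at most `k - 1`, submodularities, pairs and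
  -- demands in `A` would account for at most `4 ^ n`, `4 ^ n` and `2 ^ n` times `k - 1`, hence the
  -- factor 3 in `hΛ`.
  let h : Finset (Fin n) → ℝ := fun Z => if Z ∈ A then 0 else 1
  have h1 := hx.2 h (by simp [h, hA0])
  have hxr : ∀ j, (0 : ℝ) ≤ x j := hx.1
  have e1 : -((4 : ℝ) ^ n * (k - 1)) ≤ elemValue h ⬝ᵥ fun j => (x j : ℝ) := by
    rw [dotProduct, Fintype.sum_sum_type]
    have a1 : ∀ q : Finset (Fin n) × Finset (Fin n),
        -((k : ℝ) - 1) ≤ elemValue h (Sum.inl q) * x (Sum.inl q) := by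
      rintro ⟨I, J⟩
      have hxx := hxr (Sum.inl (I, J))
      simp only [elemValue, Sum.elim_inl, defect, h]
      have d1 := hdown I (I ∪ J) Finset.subset_union_left
      have d2 := hdown J (I ∪ J) Finset.subset_union_right
      have d3 := hdown (I ∩ J) I Finset.inter_subset_left
      have d4 := hdown (I ∩ J) J Finset.inter_subset_right
      by_cases hc : I ∈ A ∧ J ∈ A ∧ I ∪ J ∉ A
      · obtain ⟨c1, c2, c3⟩ := hc
        have : (x (Sum.inl (I, J)) : ℝ) ≤ k - 1 := by
          exact_mod_cast Int.le_sub_one_of_lt (hIJ I J c1 c2 c3)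
        simp only [c1, c2, c3, d3 c1, if_true, if_false]
        linarith
      · refine (neg_nonpos.2 hk1).trans (mul_nonneg ?_ hxx)
        by_cases c1 : I ∈ A <;> by_cases c2 : J ∈ A <;> by_cases c3 : I ∪ J ∈ A <;>
          by_cases c4 : I ∩ J ∈ A <;> simp [c1, c2, c3, c4] <;> tauto
    have a2 : 0 ≤ ∑ q, elemValue h (Sum.inr q) * x (Sum.inr q) := by
      refine Finset.sum_nonneg fun q _ => mul_nonneg ?_ (hxr _)
      have d1 := hdown q.1 (q.1 ∪ q.2) Finset.subset_union_left
      simp only [elemValue, Sum.elim_inr, h]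
      by_cases c1 : q.1 ∪ q.2 ∈ A
      · simp [c1, d1 c1]
      · by_cases c2 : q.1 ∈ A <;> simp [c1, c2]
    have a3 := Finset.sum_le_sum fun q (_ : q ∈ Finset.univ) => a1 q
    rw [Finset.sum_const, Finset.card_univ, Fintype.card_prod, card_finset_fin, ← mul_pow,
      nsmul_eq_mul] at a3
    push_cast at a3
    norm_num at a3
    linarith
  have e2 : flowValue δ h ≤ (4 : ℝ) ^ n * (k - 1) := by
    have a1 : ∀ p : Pair n, (δ p : ℝ) * cond h p ≤ (k : ℝ) - 1 := by
      intro p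
      have d1 := hdown _ _ p.2.1
      simp only [cond, h]
      by_cases c1 : p.lower ∈ A <;> by_cases c2 : p.upper ∈ A
      · simpa [c1, c2] using hk1
      · have : (δ p : ℝ) ≤ k - 1 := by
          exact_mod_cast Int.le_sub_one_of_lt (lt_of_not_ge fun hge => c2 (hup p hge c1))
        simpa [c1, c2] using this
      · exact absurd (d1 c2) c1
      · simpa [c1, c2] using hk1
    refine (Finset.sum_le_sum fun p _ => a1 p).trans ?_
    rw [Finset.sum_const, Finset.card_univ, nsmul_eq_mul]
    refine mul_le_mul_of_nonneg_right ?_ hk1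
    exact_mod_cast card_pair_le
  have e3 : ∑ Z, (lam Z : ℝ) - 2 ^ n * (k - 1) ≤ ∑ Z, (lam Z : ℝ) * h Z := by
    have a1 : ∀ Z, (lam Z : ℝ) - (k - 1) ≤ lam Z * h Z := by
      intro Z
      by_cases c : Z ∈ A
      · have : (lam Z : ℝ) ≤ k - 1 := by
          by_cases hZ : Z = ∅
          · rw [hZ, hlam0]; simpa using hk1
          · exact_mod_cast Int.le_sub_one_of_lt (hB Z c (Finset.nonempty_iff_ne_empty.2 hZ))
        simp only [h, c, if_true, mul_zero]
        linarith
      · simp only [h, c, if_false, mul_one]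
        linarith
    refine le_trans (le_of_eq ?_) (Finset.sum_le_sum fun Z _ => a1 Z)
    rw [Finset.sum_sub_distrib, Finset.sum_const, Finset.card_univ, card_finset_fin, nsmul_eq_mul]
    push_cast
    ring
  rw [balance_eq] at h1
  have e4 : 3 * 4 ^ n * ((k : ℝ) - 1) < ∑ Z, (lam Z : ℝ) := by exact_mod_cast hΛ
  have e5 : (2 : ℝ) ^ n * (k - 1) ≤ 4 ^ n * (k - 1) :=
    mul_le_mul_of_nonneg_right (pow_le_pow_left₀ (by norm_num) (by norm_num) n) hk1
  linarith

/-- The vector `∑_Z lam_Z e_{Z|∅}`. -/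
def emptyLower (lam : Finset (Fin n) → ℤ) (p : Pair n) : ℤ := if p.lower = ∅ then lam p.upper else 0

/-- Being a minimal witness depends only on the balance, which collecting and delivering units
preserve. -/
theorem IsMinWitness.congr {δ δ' : Pair n → ℤ} {lam lam' : Finset (Fin n) → ℤ} {x : Elem n → ℤ}
    (hx : IsMinWitness δ lam x)
    (hbal : ∀ h : Finset (Fin n) → ℝ, h ∅ = 0 → balance δ' lam' h = balance δ lam h) :
    IsMinWitness δ' lam' x :=
  ⟨⟨hx.1.1, fun h h0 => (hx.1.2 h h0).trans (hbal h h0).symm⟩, fun y hy =>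
    hx.2 y ⟨hy.1, fun h h0 => (hy.2 h h0).trans (hbal h h0)⟩⟩

/-- Minimality survives because a cheaper witness for the new inequality, with the `k` units put
back, would beat `x`. -/
theorem IsMinWitness.sub_single {δ δ' : Pair n → ℤ} {lam : Finset (Fin n) → ℤ} {x : Elem n → ℤ}
    (hx : IsMinWitness δ lam x) {k : ℤ} (hk : 0 ≤ k) {I J : Finset (Fin n)}
    (hxk : k ≤ x (Sum.inl (I, J)))
    (hbal : ∀ h : Finset (Fin n) → ℝ, h ∅ = 0 →
      balance δ' lam h = balance δ lam h - k * defect h I J) :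
    ∃ x' : Elem n → ℤ, IsMinWitness δ' lam x' ∧ submodWeight x' + k = submodWeight x := by
  classical
  have hev : ∀ h : Finset (Fin n) → ℝ, elemValue h (Sum.inl (I, J)) = defect h I J := fun _ => rfl
  have hw : submodWeight (x - Pi.single (Sum.inl (I, J)) k) + k = submodWeight x := by
    simp [submodWeight, Finset.sum_sub_distrib, Pi.single_apply]
  have hcast : (fun j => (((x - Pi.single (Sum.inl (I, J)) k : Elem n → ℤ) j : ℤ) : ℝ)) =
      (fun j => (x j : ℝ)) - Pi.single (Sum.inl (I, J)) (k : ℝ) := by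
    ext j
    by_cases hj : j = Sum.inl (I, J)
    · subst hj; simp
    · simp [hj]
  refine ⟨x - Pi.single (Sum.inl (I, J)) k, ⟨⟨?_, fun h h0 => ?_⟩, fun y hy => ?_⟩, hw⟩
  · intro j
    by_cases hj : j = Sum.inl (I, J)
    · subst hj
      have : (k : ℝ) ≤ x (Sum.inl (I, J)) := by exact_mod_cast hxk
      simpa using this
    · simpa [hj] using hx.1.1 j
  · rw [hcast, dotProduct_sub, hx.1.2 h h0, dotProduct_single, hev, hbal h h0]
    ring
  · have h1 := hx.2 (y + Pi.single (Sum.inl (I, J)) (k : ℝ)) ⟨?_, fun h h0 => ?_⟩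
    · have h2 : submodWeight (y + Pi.single (Sum.inl (I, J)) (k : ℝ)) = submodWeight y + k := by
        simp [submodWeight, Finset.sum_add_distrib, Pi.single_apply]
      have h3 : ((submodWeight (x - Pi.single (Sum.inl (I, J)) k) : ℤ) : ℝ) + k =
          (submodWeight x : ℤ) := by exact_mod_cast hw
      linarith
    · refine add_nonneg hy.1 (Pi.single_nonneg.2 ?_)
      exact_mod_cast hk
    · rw [dotProduct_add, hy.2 h h0, dotProduct_single, hev, hbal h h0]
      ring

/-- One round either satisfies a fixed fraction of the remaining demand or uses up a
submodularity weight of that size. -/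
theorem exists_round {δ : Pair n → ℤ} {lam : Finset (Fin n) → ℤ} {x : Elem n → ℤ} (hδ : 0 ≤ δ)
    (hlam : 0 ≤ lam) (hlam0 : lam ∅ = 0) (hx : IsMinWitness δ lam x) (hpos : 0 < ∑ Z, lam Z) :
    ∃ (k : ℤ) (δ' : Pair n → ℤ) (lam' : Finset (Fin n) → ℤ) (x' : Elem n → ℤ) (l : ℕ),
      0 < k ∧ ∑ Z, lam Z ≤ 3 * 4 ^ n * k ∧ 0 ≤ δ' ∧ 0 ≤ lam' ∧ lam' ∅ = 0 ∧ lam' ≤ lam ∧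
      IsMinWitness δ' lam' x' ∧ l ≤ 2 ^ n + 2 ∧
      Reaches δ (δ' + emptyLower (lam - lam')) l ∧
      (∑ Z, lam' Z + k = ∑ Z, lam Z ∧ submodWeight x' = submodWeight x ∨
        ∑ Z, lam' Z = ∑ Z, lam Z ∧ submodWeight x' + k = submodWeight x) := by
  classical
  set Λ := ∑ Z, lam Z with hΛ
  have hq : (0 : ℤ) < 3 * 4 ^ n := by positivity
  -- `k = ⌈Λ / (3 * 4 ^ n)⌉` is the largest chunk that the cut inequality allows.
  obtain ⟨k, hk, hk1, hk2⟩ : ∃ k : ℤ, 0 < k ∧ Λ ≤ 3 * 4 ^ n * k ∧ 3 * 4 ^ n * (k - 1) < Λ := by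
    refine ⟨(Λ - 1) / (3 * 4 ^ n) + 1, ?_, ?_, ?_⟩
    · have : 0 ≤ (Λ - 1) / (3 * 4 ^ n) := Int.ediv_nonneg (by omega) hq.le
      omega
    · have := Int.lt_ediv_add_one_mul_self (Λ - 1) hq
      rw [mul_comm]
      omega
    · have := Int.ediv_mul_le (Λ - 1) hq.ne'
      rw [add_sub_cancel_right, mul_comm]
      omega
  obtain ⟨A, hA0, hA, hup, hdown⟩ := exists_collecting_family hδ hk
  have hcard : A.card ≤ 2 ^ n := by
    rw [← card_finset_fin (n := n)]
    exact Finset.card_le_univ A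
  rcases exists_large_coefficient hx.1 hlam0 hk hk2 hA0 hup hdown with
    ⟨B, hBA, hB0, hB⟩ | ⟨I, J, hI, hJ, hIJ, hxk⟩
  · obtain ⟨δ', l, hl, h0', hr, -, hf⟩ := hA B hBA hB0
    refine ⟨k, δ', lam - Pi.single B k, x, l, hk, hk1, h0', ?_, ?_, ?_, hx.congr ?_, by omega, ?_,
      Or.inl ⟨?_, rfl⟩⟩
    · intro Z
      by_cases hZ : Z = B
      · subst hZ; simpa using hB
      · simpa [hZ] using hlam Z
    · simp [hlam0, hB0.symm]
    · exact sub_le_self _ (Pi.single_nonneg.2 hk.le)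
    · intro h h0
      have : ∀ Z, (((lam - Pi.single B k : Finset (Fin n) → ℤ) Z : ℤ) : ℝ) * h Z =
          lam Z * h Z - if Z = B then k * h B else 0 := by
        intro Z
        by_cases hZ : Z = B
        · subst hZ; simp [sub_mul]
        · simp [hZ]
      rw [balance_eq, balance_eq, ← hf h h0]
      simp only [this, Finset.sum_sub_distrib, Finset.sum_ite_eq', Finset.mem_univ, if_true]
      ring
    · have : emptyLower (lam - (lam - Pi.single B k)) = k • singleInt ∅ B := by
        ext p
        by_cases h1 : p.lower = ∅ <;> by_cases h2 : p.upper = B <;>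
          simp [emptyLower, singleInt, h1, h2]
      rw [this]
      exact hr
    · simp [Finset.sum_sub_distrib, hΛ]
  · have hI0 : I ≠ ∅ := by
      rintro rfl
      simp only [Finset.empty_union] at hIJ
      exact hIJ hJ
    have hIJ' : ¬ I ⊆ J := fun h => hIJ (by rwa [Finset.union_eq_right.2 h])
    have hJI' : ¬ J ⊆ I := fun h => hIJ (by rwa [Finset.union_eq_left.2 h])
    have hss : I ∩ J ⊂ I := ⟨Finset.inter_subset_left, fun h =>
      hIJ' (h.trans Finset.inter_subset_right)⟩
    -- The `k` units collected at `I` are split at `I ∩ J`, and submodularity moves the conditional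
    -- part to `(J, I ∪ J)`: two steps beyond the collection.
    obtain ⟨δ', l, hl, h0', hr, -, hf⟩ := hA I hI hI0
    have hr1 := reaches_decomposition hk h0' hss hr
    have heq : δ' + k • singleInt (I ∩ J) I + k • singleInt ∅ (I ∩ J) +
        k • (ProofStep.submodularity I J hIJ' hJI').vecInt =
          δ' + k • singleInt ∅ (I ∩ J) + k • singleInt J (I ∪ J) := by
      simp only [ProofStep.vecInt, smul_sub]
      abel
    have hnn : 0 ≤ δ' + k • singleInt ∅ (I ∩ J) + k • singleInt J (I ∪ J) :=
      add_nonneg (add_nonneg h0' (smul_nonneg hk.le (singleInt_nonneg _ _)))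
        (smul_nonneg hk.le (singleInt_nonneg _ _))
    have hr2 := hr1.snoc k (ProofStep.submodularity I J hIJ' hJI') hk (by rw [heq]; exact hnn)
    rw [heq] at hr2
    obtain ⟨x', hx', hw⟩ := hx.sub_single (δ' := _) hk.le hxk
      (show ∀ h : Finset (Fin n) → ℝ, h ∅ = 0 →
        balance (δ' + k • singleInt ∅ (I ∩ J) + k • singleInt J (I ∪ J)) lam h =
          balance δ lam h - k * defect h I J by
        intro h h0
        rw [balance_eq, balance_eq, ← hf h h0, flowValue_add, flowValue_add, flowValue_smul,
          flowValue_smul, flowValue_singleInt (Finset.empty_subset _),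
          flowValue_singleInt Finset.subset_union_right, h0, defect]
        ring)
    refine ⟨k, _, lam, x', l + 1 + 1, hk, hk1, hnn, hlam, hlam0, le_rfl, hx', by omega, ?_,
      Or.inr ⟨rfl, hw⟩⟩
    have : emptyLower (lam - lam) = (0 : Pair n → ℤ) := by
      ext p
      simp [emptyLower]
    rw [this, add_zero]
    exact hr2

theorem emptyLower_nonneg {lam : Finset (Fin n) → ℤ} (hlam : 0 ≤ lam) : 0 ≤ emptyLower lam := by
  intro p
  unfold emptyLower
  split_ifs
  · exact hlam _
  · exact le_rfl

/-! ### The number of rounds -/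

/-- The number of rounds is logarithmic in the initial total weight. -/
theorem exists_reaches {δ : Pair n → ℤ} {lam : Finset (Fin n) → ℤ} {x : Elem n → ℤ} (hδ : 0 ≤ δ)
    (hlam : 0 ≤ lam) (hlam0 : lam ∅ = 0) (hx : IsMinWitness δ lam x) :
    ∃ (δ' : Pair n → ℤ) (l : ℕ), 0 ≤ δ' ∧ Reaches δ (δ' + emptyLower lam) l ∧
      (l : ℝ) ≤ (2 ^ n + 2) * (12 * n ^ 2 * 16 ^ n *
        Real.log (((n ^ 2 * 4 ^ n * ∑ Z, lam Z + submodWeight x : ℤ) : ℝ) + 1)) := by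
  induction hN : (n ^ 2 * 4 ^ n * ∑ Z, lam Z + submodWeight x : ℤ).toNat
    using Nat.strong_induction_on generalizing δ lam x with
  | _ N ih =>
  have hw := hx.submodWeight_le hδ hlam
  have hw0 : 0 ≤ submodWeight x := Finset.sum_nonneg fun q _ => by
    have : (0 : ℝ) ≤ x (Sum.inl q) := hx.1.1 _
    exact_mod_cast this
  rcases (Finset.sum_nonneg fun Z _ => hlam Z : (0 : ℤ) ≤ ∑ Z, lam Z).eq_or_lt with hz | hpos
  · have hl0 : lam = 0 := by
      ext Z
      exact (Finset.sum_eq_zero_iff_of_nonneg fun Z _ => hlam Z).1 hz.symm Z (Finset.mem_univ Z)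
    refine ⟨δ, 0, hδ, ?_, ?_⟩
    · have : emptyLower lam = (0 : Pair n → ℤ) := by
        ext p; simp [emptyLower, hl0]
      rw [this, add_zero]
      exact .refl hδ
    · rw [← hz, mul_zero] at hw
      have : submodWeight x = 0 := le_antisymm hw hw0
      rw [← hz, this]
      simp
  have hn : 1 ≤ n := by
    rcases Nat.eq_zero_or_pos n with rfl | h
    · exfalso
      have : ∑ Z : Finset (Fin 0), lam Z = 0 := Finset.sum_eq_zero fun Z _ => by
        rw [Finset.eq_empty_of_isEmpty Z, hlam0]
      omega
    · exact h
  obtain ⟨k, δ', lam', x', l, hk, hkΛ, hδ', hlam', hlam0', hle, hx', hl, hr, hdec⟩ :=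
    exists_round hδ hlam hlam0 hx hpos
  have hM : (1 : ℤ) ≤ n ^ 2 * 4 ^ n := by
    have h1 : (1 : ℤ) ≤ n := by exact_mod_cast hn
    have h2 : (1 : ℤ) ≤ n ^ 2 := one_le_pow₀ h1
    have h3 : (1 : ℤ) ≤ 4 ^ n := one_le_pow₀ (by norm_num)
    nlinarith
  set M : ℤ := n ^ 2 * 4 ^ n with hMdef
  have hw' := hx'.submodWeight_le hδ' hlam'
  have hw0' : 0 ≤ submodWeight x' := Finset.sum_nonneg fun q _ => by
    have : (0 : ℝ) ≤ x' (Sum.inl q) := hx'.1.1 _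
    exact_mod_cast this
  have hΛ' : (0 : ℤ) ≤ ∑ Z, lam' Z := Finset.sum_nonneg fun Z _ => hlam' Z
  -- The potential drops by at least `k` in either case of a round. By the weight bound it is at
  -- most `2 * M * ∑ Z, lam Z`, hence at most `6 * n ^ 2 * 16 ^ n * k`.
  set Ψ := M * ∑ Z, lam Z + submodWeight x with hΨ
  set Ψ' := M * ∑ Z, lam' Z + submodWeight x' with hΨ'
  have hΨ1 : 1 ≤ Ψ := by nlinarith
  have hΨ'0 : 0 ≤ Ψ' := by positivity
  have hΨle : Ψ' + k ≤ Ψ := by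
    rcases hdec with ⟨h1, h2⟩ | ⟨h1, h2⟩
    · rw [hΨ, hΨ', ← h1, h2]
      nlinarith
    · rw [hΨ, hΨ', h1, ← h2]
      linarith
  have hΨK : Ψ ≤ 6 * n ^ 2 * 16 ^ n * k := by
    have e : (6 * n ^ 2 * 16 ^ n * k : ℤ) = 2 * (M * (3 * 4 ^ n * k)) := by
      rw [hMdef, show (16 : ℤ) = 4 * 4 by norm_num, mul_pow]; ring
    have := mul_le_mul_of_nonneg_left hkΛ (by omega : 0 ≤ M)
    rw [e]
    omega
  obtain ⟨δ₂, l₂, hδ₂, hr₂, hl₂⟩ := ih _ (by omega) hδ' hlam' hlam0' hx' rfl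
  refine ⟨δ₂, l + l₂, hδ₂, ?_, ?_⟩
  · have h1 := hr₂.add_right (emptyLower_nonneg (sub_nonneg.2 hle))
    have h2 : emptyLower lam = emptyLower lam' + emptyLower (lam - lam') := by
      ext p
      by_cases hp : p.lower = ∅ <;> simp [emptyLower, hp]
    rw [h2, ← add_assoc]
    exact hr.trans h1
  -- The shift by 1 keeps the logarithm harmless at `Ψ' = 0`; `Ψ + 1 ≤ 2 * Ψ` turns 6 into 12.
  · have hk1 : Ψ + 1 ≤ 12 * n ^ 2 * 16 ^ n * (Ψ - Ψ') := by
      have h1 : (6 * n ^ 2 * 16 ^ n * k : ℤ) ≤ 6 * n ^ 2 * 16 ^ n * (Ψ - Ψ') :=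
        mul_le_mul_of_nonneg_left (by linarith) (by positivity)
      linarith
    have hk2 : (Ψ : ℝ) + 1 ≤ 12 * n ^ 2 * 16 ^ n * (Ψ - Ψ') := by exact_mod_cast hk1
    have hP : (0 : ℝ) < Ψ + 1 := by
      have : (1 : ℝ) ≤ Ψ := by exact_mod_cast hΨ1
      linarith
    have hP' : (0 : ℝ) < Ψ' + 1 := by
      have : (0 : ℝ) ≤ Ψ' := by exact_mod_cast hΨ'0
      linarith
    have hlog : Real.log (Ψ' + 1) - Real.log (Ψ + 1) ≤ (Ψ' + 1) / (Ψ + 1) - 1 := by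
      rw [← Real.log_div hP'.ne' hP.ne']
      exact Real.log_le_sub_one_of_pos (div_pos hP' hP)
    have hfrac : 1 ≤ 12 * n ^ 2 * 16 ^ n * (1 - (Ψ' + 1) / ((Ψ : ℝ) + 1)) := by
      have e : 12 * n ^ 2 * 16 ^ n * (1 - (Ψ' + 1) / ((Ψ : ℝ) + 1)) =
          12 * n ^ 2 * 16 ^ n * (Ψ - Ψ') / (Ψ + 1) := by
        field_simp
        ring
      rw [e, le_div_iff₀ hP, one_mul]
      exact hk2
    have hstep : 12 * n ^ 2 * 16 ^ n * Real.log (Ψ' + 1) + 1 ≤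
        12 * n ^ 2 * 16 ^ n * Real.log ((Ψ : ℝ) + 1) := by
      have := mul_le_mul_of_nonneg_left hlog (by positivity : (0 : ℝ) ≤ 12 * n ^ 2 * 16 ^ n)
      linarith
    have hl' : (l : ℝ) ≤ 2 ^ n + 2 := by exact_mod_cast hl
    have := mul_le_mul_of_nonneg_left hstep (by positivity : (0 : ℝ) ≤ 2 ^ n + 2)
    push_cast
    linarith

/-! ### Duality with bounded denominators -/

theorem isPolymatroid_of_elemValue_nonneg {h : Finset (Fin n) → ℝ} (h0 : h ∅ = 0)
    (hh : 0 ≤ elemValue h) : IsPolymatroid h := by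
  have hm : ∀ X Y, X ⊆ Y → h X ≤ h Y := fun X Y hXY => by
    have := hh (Sum.inr (X, Y))
    simp only [elemValue, Sum.elim_inr, Finset.union_eq_right.2 hXY, Pi.zero_apply] at this
    linarith
  refine ⟨h0, fun X => h0 ▸ hm ∅ X (Finset.empty_subset X), hm, fun X Y => ?_⟩
  have := hh (Sum.inl (X, Y))
  simp only [elemValue, Sum.elim_inl, defect, Pi.zero_apply] at this
  linarith

theorem IsPolymatroid.const_mul {h : Finset (Fin n) → ℝ} (hh : IsPolymatroid h) {r : ℝ}
    (hr : 0 ≤ r) : IsPolymatroid fun Z => r * h Z where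
  empty := by simp [hh.empty]
  nonneg X := mul_nonneg hr (hh.nonneg X)
  mono X Y hXY := mul_le_mul_of_nonneg_left (hh.mono X Y hXY) hr
  submodular X Y := by
    have := mul_le_mul_of_nonneg_left (hh.submodular X Y) hr
    linarith

theorem denominator_bound {r R D : ℕ} (hr : r ≤ R) (hR : R ≤ 2 ^ n + 1)
    (hD : D ≤ r.factorial * (R * 2 ^ 2) ^ r) : D ≤ 4 ^ ((n + 2) * (2 ^ n + 1)) := by
  have h1 : R ≤ 2 ^ (n + 1) := by
    have : 1 ≤ 2 ^ n := Nat.one_le_two_pow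
    rw [pow_succ]; omega
  have h2 : r * (R * 2 ^ 2) ≤ 4 ^ (n + 2) := by
    calc r * (R * 2 ^ 2) ≤ 2 ^ (n + 1) * (2 ^ (n + 1) * 2 ^ 2) := by
          gcongr
          exact hr.trans h1
      _ = 4 ^ (n + 2) := by
          rw [show 4 = 2 ^ 2 by norm_num, ← pow_mul, ← pow_add, ← pow_add]
          congr 1
          ring
  calc D ≤ r ^ r * (R * 2 ^ 2) ^ r := hD.trans (Nat.mul_le_mul_right _ r.factorial_le_pow)
    _ = (r * (R * 2 ^ 2)) ^ r := (mul_pow _ _ _).symm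
    _ ≤ (4 ^ (n + 2)) ^ r := Nat.pow_le_pow_left h2 r
    _ ≤ (4 ^ (n + 2)) ^ (2 ^ n + 1) := Nat.pow_le_pow_right (by positivity) (hr.trans hR)
    _ = 4 ^ ((n + 2) * (2 ^ n + 1)) := (pow_mul _ _ _).symm

theorem balance_smul (k : ℤ) (δ : Pair n → ℤ) (lam : Finset (Fin n) → ℤ)
    (h : Finset (Fin n) → ℝ) : balance (k • δ) (k • lam) h = k * balance δ lam h := by
  simp [balance, mul_sub, Finset.mul_sum, mul_assoc]

/-- A multiple of every inequality with a witness has a minimal witness. -/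
theorem IsWitness.exists_isMinWitness {δ : Pair n → ℤ} {lam : Finset (Fin n) → ℤ} {x : Elem n → ℝ}
    (hx : IsWitness δ lam x) : ∃ D : ℕ, 0 < D ∧ D ≤ 4 ^ ((n + 2) * (2 ^ n + 1)) ∧
      ∃ z : Elem n → ℤ, IsMinWitness ((D : ℤ) • δ) ((D : ℤ) • lam) z := by
  obtain ⟨D, hD, ⟨r, hr, hDr⟩, z, hz, hmin⟩ := exists_optimal_solution_denominator (elemMatrix n)
    (balanceVec δ lam) 2 (by simpa using abs_elemMatrix_le) (Sum.elim 1 0)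
    (by rintro (q | q) <;> simp) ⟨x, (isWitness_iff _ _ _).1 hx⟩
  have hcost : ∀ w : Elem n → ℝ, Sum.elim 1 0 ⬝ᵥ w = submodWeight w := fun w => by
    simp [dotProduct, submodWeight]
  have hD' : (0 : ℝ) < D := by exact_mod_cast hD
  refine ⟨D, hD, denominator_bound hr (by simp) hDr, fun j => z j, ?_, fun y hy => ?_⟩
  · rw [isWitness_iff]
    refine ⟨fun j => by simp, ?_⟩
    simp only [Int.cast_natCast]
    rw [hz]
    ext W
    simp [balanceVec, mul_sub, Finset.mul_sum, mul_assoc]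
  · have hy' : IsWitness δ lam ((D : ℝ)⁻¹ • y) := by
      refine ⟨smul_nonneg (by positivity) hy.1, fun h h0 => ?_⟩
      rw [dotProduct_smul, hy.2 h h0, balance_smul, smul_eq_mul, Int.cast_natCast,
        inv_mul_cancel_left₀ hD'.ne']
    have := hmin _ hy'.1 ((isWitness_iff _ _ _).1 hy').2
    rw [dotProduct_smul, smul_eq_mul, mul_inv_cancel_left₀ hD'.ne', hcost, hcost] at this
    simpa [submodWeight] using this

/-- The constraint matrix of the dual program: the first rows say that `⟨δ, h⟩ - ⟨lam, h⟩` is a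
combination of elementary inequalities, the last row computes the total weight of `lam`. -/
def dualMatrix (P : Finset (Pair n)) (T : Finset (Finset (Fin n))) :
    Matrix (Option (Finset (Fin n))) ((P ⊕ T) ⊕ Elem n) ℤ
  | none => Sum.elim (Sum.elim 0 1) 0
  | some W => Sum.elim (Sum.elim (fun p => unitVec p.1.upper W - unitVec p.1.lower W)
      (fun B => -unitVec B.1 W)) (fun j => -elemMatrix n W j)

theorem abs_dualMatrix_le (P : Finset (Pair n)) (T : Finset (Finset (Fin n)))
    (i : Option (Finset (Fin n))) (j : (P ⊕ T) ⊕ Elem n) : |dualMatrix P T i j| ≤ 2 := by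
  rcases i with _ | W <;> rcases j with (p | B) | j
  · simp [dualMatrix]
  · simp [dualMatrix]
  · simp [dualMatrix]
  · have h1 := unitVec_nonneg_and_le_one p.1.upper W
    have h2 := unitVec_nonneg_and_le_one p.1.lower W
    simp only [dualMatrix, Sum.elim_inl]
    rw [abs_le]
    constructor <;> linarith
  · have h1 := unitVec_nonneg_and_le_one B.1 W
    simp only [dualMatrix, Sum.elim_inl, Sum.elim_inr]
    rw [abs_le]
    constructor <;> linarith
  · simpa [dualMatrix] using abs_elemMatrix_le W j

/-- Strong duality for the polymatroid bound, with an integral solution of bounded size. -/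
theorem exists_dual_solution (P : Finset (Pair n)) (T : Finset (Finset (Fin n))) (N : Pair n → ℝ)
    (hN : ∀ p ∈ P, 0 ≤ N p) (γ : ℝ)
    (H : ∀ h : Finset (Fin n) → ℝ, IsPolymatroid h → ∀ s t : ℝ, 0 ≤ s →
      (∀ p ∈ P, cond h p ≤ s * N p) → (∀ B ∈ T, t ≤ h B) → t ≤ s * γ) :
    ∃ D : ℕ, 0 < D ∧ D ≤ 4 ^ ((n + 2) * (2 ^ n + 1)) ∧
      ∃ (δ : Pair n → ℤ) (lam : Finset (Fin n) → ℤ) (x : Elem n → ℝ), 0 ≤ δ ∧ 0 ≤ lam ∧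
        (∀ p ∉ P, δ p = 0) ∧ (∀ B ∉ T, lam B = 0) ∧ ∑ Z, lam Z = D ∧
        ∑ p, (δ p : ℝ) * N p ≤ D * γ ∧ IsWitness δ lam x := by
  classical
  let c : (P ⊕ T) ⊕ Elem n → ℝ := Sum.elim (Sum.elim (fun p => N p.1) 0) 0
  let b : Option (Finset (Fin n)) → ℤ := fun i => i.elim 1 0
  obtain ⟨x, hx0, hx, hxc⟩ := exists_nonneg_solution_cost_le
    ((dualMatrix P T).map (Int.cast : ℤ → ℝ)) (fun i => (b i : ℝ)) c γ (by
      intro y s hs hy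
      simp only [Fintype.sum_option, map_apply] at hy ⊢
      set y' : Finset (Fin n) → ℝ := Function.update (fun W => y (some W)) ∅ 0 with hy'
      have e0 : y' ∅ = 0 := by simp [hy']
      have hT' : ∀ B ∈ T, y' B ≤ y none := by
        intro B hB
        have := hy (Sum.inl (Sum.inr ⟨B, hB⟩))
        simp only [dualMatrix, Sum.elim_inl, Sum.elim_inr, Int.cast_neg, mul_neg,
          Finset.sum_neg_distrib, sum_mul_unitVec, c, Pi.one_apply, Pi.zero_apply] at this
        push_cast at this
        linarith
      have hP' : ∀ p ∈ P, -(s * N p) ≤ y' p.upper - y' p.lower := by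
        intro p hp
        have := hy (Sum.inl (Sum.inl ⟨p, hp⟩))
        simp only [dualMatrix, Sum.elim_inl, Int.cast_sub, mul_sub,
          Finset.sum_sub_distrib, sum_mul_unitVec, c, Pi.zero_apply] at this
        push_cast at this
        linarith
      have hE' : ∀ j, elemValue y' j ≤ 0 := by
        intro j
        have := hy (Sum.inr j)
        simp only [dualMatrix, Sum.elim_inr, Int.cast_neg, mul_neg,
          Finset.sum_neg_distrib, sum_mul_elemMatrix, c, Pi.zero_apply] at this
        push_cast at this
        linarith
      -- With the signs of `dualMatrix`, the negated multipliers form a polymatroid and `-y none` is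
      -- a lower bound for it on the targets.
      have hpoly : IsPolymatroid fun Z => -y' Z := by
        refine isPolymatroid_of_elemValue_nonneg (by simp [e0]) ?_
        intro j
        have := hE' j
        rcases j with j | j <;>
        · simp only [elemValue, Sum.elim_inl, Sum.elim_inr, defect, Pi.zero_apply] at this ⊢
          linarith
      have := H _ hpoly s (-y none) hs (fun p hp => by
        have := hP' p hp
        simp only [cond]
        linarith) (fun B hB => neg_le_neg (hT' B hB))
      simp [b]
      linarith)
  obtain ⟨D, hD, ⟨r, hr, hDr⟩, z, hz, hmin⟩ := exists_optimal_solution_denominator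
    (dualMatrix P T) b 2 (by simpa using abs_dualMatrix_le P T) c
    (by
      rintro ((p | B) | j)
      · exact hN _ p.2
      · exact le_rfl
      · exact le_rfl) ⟨x, hx0, hx⟩
  let δ : Pair n → ℤ := fun p => if h : p ∈ P then z (Sum.inl (Sum.inl ⟨p, h⟩)) else 0
  let lam : Finset (Fin n) → ℤ := fun B => if h : B ∈ T then z (Sum.inl (Sum.inr ⟨B, h⟩)) else 0
  have hδ : ∀ f : Pair n → ℝ,
      ∑ p : P, (z (Sum.inl (Sum.inl p)) : ℝ) * f p.1 = ∑ p, (δ p : ℝ) * f p := by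
    intro f
    rw [← Finset.sum_subset (Finset.subset_univ P) fun p _ hp => by simp [δ, hp],
      ← Finset.sum_coe_sort P]
    exact Finset.sum_congr rfl fun p _ => by simp [δ, p.2]
  have hlam : ∀ f : Finset (Fin n) → ℝ,
      ∑ B : T, (z (Sum.inl (Sum.inr B)) : ℝ) * f B.1 = ∑ B, (lam B : ℝ) * f B := by
    intro f
    rw [← Finset.sum_subset (Finset.subset_univ T) fun p _ hp => by simp [lam, hp],
      ← Finset.sum_coe_sort T]
    exact Finset.sum_congr rfl fun p _ => by simp [lam, p.2]
  refine ⟨D, hD, denominator_bound hr (by simp) hDr, δ, lam, fun j => z (Sum.inr j), fun p => ?_,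
    fun B => ?_, fun p hp => dif_neg hp, fun B hB => dif_neg hB, ?_, ?_, ?_⟩
  · simp only [δ]
    split_ifs <;> simp
  · simp only [lam]
    split_ifs <;> simp
  · have h1 := congrFun hz none
    have h2 := hlam 1
    simp only [Pi.one_apply, mul_one] at h2
    simp only [mulVec, dotProduct, map_apply, Fintype.sum_sum_type, dualMatrix, Sum.elim_inl,
      Sum.elim_inr, b, Option.elim, Pi.zero_apply, Pi.one_apply, Int.cast_zero, Int.cast_one,
      zero_mul, one_mul, Finset.sum_const_zero, zero_add, add_zero, mul_one, h2] at h1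
    exact_mod_cast h1
  · have h1 := (hmin x hx0 hx).trans (mul_le_mul_of_nonneg_left hxc (Nat.cast_nonneg D))
    have h2 := hδ N
    simp only [dotProduct, Fintype.sum_sum_type, c, Sum.elim_inl, Sum.elim_inr, Pi.zero_apply,
      zero_mul, Finset.sum_const_zero, add_zero] at h1
    rw [← h2]
    simpa [mul_comm] using h1
  · rw [isWitness_iff]
    refine ⟨fun j => by simp, ?_⟩
    ext W
    have h1 := congrFun hz (some W)
    simp only [mulVec, dotProduct, map_apply, Fintype.sum_sum_type, dualMatrix, Sum.elim_inl,
      Sum.elim_inr, b, Option.elim, Pi.zero_apply, Int.cast_zero, mul_zero, Int.cast_neg, neg_mul,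
      Finset.sum_neg_distrib] at h1
    have h2 := hδ fun p => (unitVec p.upper W - unitVec p.lower W : ℤ)
    have h3 := hlam fun B => unitVec B W
    simp only [mul_comm (z _ : ℝ)] at h2 h3
    rw [h2, h3] at h1
    simp only [mulVec, dotProduct, map_apply, balanceVec, Fintype.sum_sum_type]
    push_cast at h1 ⊢
    linarith

theorem flowValue_emptyLower {lam : Finset (Fin n) → ℤ} (h : Finset (Fin n) → ℝ) (h0 : h ∅ = 0) :
    flowValue (emptyLower lam) h = ∑ Z, (lam Z : ℝ) * h Z := by
  have h1 : ∀ Z, (lam Z : ℝ) * h Z = flowValue (lam Z • singleInt ∅ Z) h := fun Z => by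
    rw [flowValue_smul, flowValue_singleInt (Finset.empty_subset Z), h0, sub_zero]
  simp only [h1, flowValue]
  rw [Finset.sum_comm]
  refine Finset.sum_congr rfl fun p _ => ?_
  rw [← Finset.sum_mul]
  congr 1
  by_cases hp : p.lower = ∅ <;> simp [emptyLower, singleInt, hp]

theorem sum_emptyLower {lam : Finset (Fin n) → ℤ} (h0 : lam ∅ = 0) :
    ∑ p, emptyLower lam p = ∑ Z, lam Z := by
  have h1 := flowValue_emptyLower (lam := lam) (fun Z => if Z = ∅ then 0 else 1) (by simp)
  have h2 : ∀ Z, (lam Z : ℝ) * (if Z = ∅ then 0 else 1) = lam Z := fun Z => by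
    by_cases hZ : Z = ∅ <;> simp [hZ, h0]
  have h3 : ∀ p, (emptyLower lam p : ℝ) * cond (fun Z => if Z = ∅ then (0 : ℝ) else 1) p =
      emptyLower lam p := fun p => by
    by_cases hp : p.lower = ∅
    · have : p.upper ≠ ∅ := by
        intro e
        exact p.2.ne (show p.lower = p.upper by rw [hp, e])
      simp [cond, hp, this]
    · simp [emptyLower, hp]
  simp only [flowValue, h2, h3] at h1
  exact_mod_cast h1

/-! ### Degree constraints and the numerical bound -/

/-- The constraints hold iff they hold for the log-degree bounds of all pairs. -/
theorem satisfiesDC_iff {DC : Set (DegreeConstraint n)} {h : Finset (Fin n) → ℝ} :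
    SatisfiesDC DC h ↔ ∀ p, ((cond h p : ℝ) : EReal) ≤ logDegree DC p := by
  refine ⟨fun H p => ?_, fun H c hc => (H c.pair).trans ?_⟩
  · refine le_iInf fun c => le_iInf fun hc => le_iInf fun hp => ?_
    exact hp ▸ H c hc
  · exact iInf_le_of_le c (iInf_le_of_le hc (iInf_le_of_le rfl le_rfl))

theorem le_objective {DC : Set (DegreeConstraint n)} {targets : Set (Finset (Fin n))}
    {h : Finset (Fin n) → ℝ} (hh : IsPolymatroid h)
    (hDC : ∀ p, logDegree DC p < ⊤ → ((cond h p : ℝ) : EReal) ≤ logDegree DC p) {t : ℝ}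
    (ht : ∀ B ∈ targets, t ≤ h B) : (t : EReal) ≤ objective DC targets := by
  have hs : SatisfiesDC DC h := satisfiesDC_iff.2 fun p => by
    rcases lt_or_eq_of_le (le_top : logDegree DC p ≤ ⊤) with hp | hp
    · exact hDC p hp
    · rw [hp]; exact le_top
  refine le_iSup₂_of_le h ⟨hh, hs⟩ ?_
  exact le_iInf₂ fun B hB => EReal.coe_le_coe_iff.2 (ht B hB)

/-- The numerical estimate behind the polynomial bound. -/
theorem length_bound {l D : ℕ} {w : ℤ} (hD : 0 < D)
    (hDle : D ≤ 4 ^ (2 * ((n + 2) * (2 ^ n + 1)))) (hw0 : 0 ≤ w) (hw : w ≤ n ^ 2 * 4 ^ n * D)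
    (hl : (l : ℝ) ≤ (2 ^ n + 2) * (12 * n ^ 2 * 16 ^ n *
        Real.log (((n ^ 2 * 4 ^ n * D + w : ℤ) : ℝ) + 1))) :
    l ≤ 1080 * (n ^ 4 * 2 ^ (7 * n) * 3 ^ n) := by
  rcases Nat.eq_zero_or_pos n with rfl | hn
  · simp at hl
    simp [hl]
  have h2n : (n : ℝ) ≤ 2 ^ n := by exact_mod_cast n.lt_two_pow_self.le
  have hn1 : (1 : ℝ) ≤ n := by exact_mod_cast hn
  have h1 : (1 : ℝ) ≤ 2 ^ n := one_le_pow₀ (by norm_num)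
  have hlog : Real.log (((n ^ 2 * 4 ^ n * D + w : ℤ) : ℝ) + 1) ≤ 30 * n * 2 ^ n := by
    have hD1 : (1 : ℝ) ≤ D := by exact_mod_cast hD
    have hw' : (w : ℝ) ≤ n ^ 2 * 4 ^ n * D := by exact_mod_cast hw
    have hw0' : (0 : ℝ) ≤ w := by exact_mod_cast hw0
    have hDle' : (D : ℝ) ≤ 4 ^ (2 * ((n + 2) * (2 ^ n + 1))) := by exact_mod_cast hDle
    have hnsq : (n : ℝ) ^ 2 ≤ 4 ^ n := by
      calc (n : ℝ) ^ 2 ≤ (2 ^ n) ^ 2 := by gcongr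
        _ = 4 ^ n := by rw [← pow_mul, mul_comm, pow_mul]; norm_num
    have h4 : (1 : ℝ) ≤ 4 ^ n := one_le_pow₀ (by norm_num)
    have hMD : (n : ℝ) ^ 2 * 4 ^ n * D ≤ 4 ^ n * 4 ^ n * 4 ^ (2 * ((n + 2) * (2 ^ n + 1))) := by
      gcongr
    have hone : (1 : ℝ) ≤ 4 ^ n * 4 ^ n * 4 ^ (2 * ((n + 2) * (2 ^ n + 1))) := by
      rw [← pow_add, ← pow_add]
      exact one_le_pow₀ (by norm_num)
    have hle : ((n ^ 2 * 4 ^ n * D + w : ℤ) : ℝ) + 1 ≤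
        4 ^ (1 + n + n + 2 * ((n + 2) * (2 ^ n + 1))) := by
      rw [add_assoc 1, pow_add, pow_add, pow_add]
      push_cast
      linarith
    have hpos : (0 : ℝ) < ((n ^ 2 * 4 ^ n * D + w : ℤ) : ℝ) + 1 := by
      push_cast
      positivity
    refine (Real.log_le_log hpos hle).trans ?_
    rw [Real.log_pow]
    have hlog4 : Real.log 4 ≤ 2 := by
      rw [show (4 : ℝ) = 2 ^ 2 by norm_num, Real.log_pow]
      have := Real.log_two_lt_d9
      push_cast
      linarith
    -- The exponent is `2 * n * 2 ^ n + 4 * 2 ^ n + 4 * n + 5`, and `2 + 4 + 4 + 5 = 15`.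
    have hexp : ((1 + n + n + 2 * ((n + 2) * (2 ^ n + 1)) : ℕ) : ℝ) ≤ 15 * n * 2 ^ n := by
      push_cast
      have : (n : ℝ) ≤ n * 2 ^ n := le_mul_of_one_le_right (by linarith) h1
      have : (2 : ℝ) ^ n ≤ n * 2 ^ n := le_mul_of_one_le_left (by positivity) hn1
      nlinarith
    calc _ ≤ 15 * n * 2 ^ n * (2 : ℝ) := by
          refine mul_le_mul hexp hlog4 (Real.log_nonneg (by norm_num)) (by positivity)
      _ = _ := by ring
  -- `1080 = 3 * 12 * 30`. The count obtained is `n ^ 3 * 2 ^ (6 * n)`; the remaining factors are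
  -- slack.
  have h5 : (l : ℝ) ≤ 1080 * (n ^ 4 * 2 ^ (7 * n) * 3 ^ n) := by
    calc (l : ℝ) ≤ (3 * 2 ^ n) * (12 * n ^ 2 * 16 ^ n * (30 * n * 2 ^ n)) := by
          refine hl.trans (mul_le_mul (by linarith) ?_ ?_ (by positivity))
          · exact mul_le_mul_of_nonneg_left hlog (by positivity)
          · refine mul_nonneg (by positivity) (Real.log_nonneg ?_)
            have hw0' : (0 : ℝ) ≤ w := by exact_mod_cast hw0
            push_cast
            have : (0 : ℝ) ≤ n ^ 2 * 4 ^ n * D := by positivity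
            linarith
      _ = 1080 * (n ^ 3 * 2 ^ (6 * n) * 1) := by
          rw [show (16 : ℝ) = 2 ^ 4 by norm_num, ← pow_mul]
          have : (2 : ℝ) ^ (6 * n) = 2 ^ n * 2 ^ (4 * n) * 2 ^ n := by
            rw [← pow_add, ← pow_add]; congr 1; ring
          rw [this]; ring
      _ ≤ 1080 * (n ^ 4 * 2 ^ (7 * n) * 3 ^ n) := by
          have h6 : (n : ℝ) ^ 3 ≤ n ^ 4 := pow_le_pow_right₀ hn1 (by norm_num)
          have h7 : (2 : ℝ) ^ (6 * n) ≤ 2 ^ (7 * n) := pow_le_pow_right₀ (by norm_num) (by omega)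
          have h8 : (1 : ℝ) ≤ 3 ^ n := one_le_pow₀ (by norm_num)
          gcongr
  exact_mod_cast h5

end ShannonFlow

/-! ### The main theorem -/

theorem mainTheorem6 :
    ∃ C : ℕ, ∀ (n : ℕ) (DC : Set (ShannonFlow.DegreeConstraint n))
      (targets : Set (Finset (Fin n))),
      0 < ShannonFlow.objective DC targets →
      ShannonFlow.objective DC targets < ⊤ →
      ∃ lam delta : ShannonFlow.Pair n → ℚ≥0,
        ShannonFlow.IsShannonFlow lam delta ∧
        ∑ p : ShannonFlow.Pair n, lam p = 1 ∧
        ∑ p : ShannonFlow.Pair n, ((delta p : ℝ) : EReal) * ShannonFlow.logDegree DC p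
          ≤ ShannonFlow.objective DC targets ∧
        (∀ p : ShannonFlow.Pair n, p.lower ≠ ∅ ∨ p.upper ∉ targets → lam p = 0) ∧
        ∃ steps : List (ℚ × ShannonFlow.ProofStep n),
          ShannonFlow.IsProofSequence lam delta steps ∧
          steps.length ≤ C * (n ^ 4 * 2 ^ (7 * n) * 3 ^ n) := by
  classical
  open ShannonFlow in
  refine ⟨1080, fun n DC targets hpos htop => ?_⟩
  obtain ⟨γ, hγ⟩ : ∃ γ : ℝ, objective DC targets = γ :=
    ⟨_, (EReal.coe_toReal htop.ne (ne_bot_of_gt hpos)).symm⟩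
  have hγ0 : 0 < γ := by
    rw [hγ] at hpos
    exact_mod_cast hpos
  obtain ⟨h₀, hh₀, hDC₀⟩ : ∃ h, IsPolymatroid h ∧ SatisfiesDC DC h := by
    obtain ⟨h, hh⟩ := lt_iSup_iff.1 hpos
    obtain ⟨hmem, -⟩ := lt_iSup_iff.1 hh
    exact ⟨h, hmem⟩
  -- A feasible polymatroid exists, which excludes the bound `N = 0` with logarithm `-∞`.
  have hdeg : ∀ p, 0 ≤ logDegree DC p := fun p =>
    le_trans (by exact_mod_cast cond_nonneg hh₀.mono p) (satisfiesDC_iff.1 hDC₀ p)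
  have hempty : ∅ ∉ targets := by
    intro hmem
    refine absurd (iSup₂_le fun h hh => ?_ : objective DC targets ≤ 0) (not_le.2 hpos)
    refine (iInf₂_le ∅ hmem).trans ?_
    rw [hh.1.empty]
    exact le_rfl
  let N : Pair n → ℝ := fun p => (logDegree DC p).toReal
  have hNcoe : ∀ p, logDegree DC p < ⊤ → ((N p : ℝ) : EReal) = logDegree DC p := fun p hp =>
    EReal.coe_toReal hp.ne (ne_bot_of_gt (lt_of_lt_of_le EReal.bot_lt_zero (hdeg p)))
  have hN : ∀ p, 0 ≤ N p := fun p => EReal.toReal_nonneg (hdeg p)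
  have hfeas : ∀ h : Finset (Fin n) → ℝ, IsPolymatroid h →
      (∀ p, logDegree DC p < ⊤ → cond h p ≤ N p) → ∀ t : ℝ, (∀ B ∈ targets, t ≤ h B) → t ≤ γ := by
    intro h hh hc t ht
    have := le_objective (targets := targets) hh (fun p hp => by
      rw [← hNcoe p hp]
      exact_mod_cast hc p hp) ht
    rw [hγ] at this
    exact_mod_cast this
  obtain ⟨D₁, hD₁, hD₁le, δ, lam, x, hδ, hlam, hδP, hlamT, hsum, hcost, hx⟩ := exists_dual_solution
    (Finset.univ.filter fun p => logDegree DC p < ⊤) (Finset.univ.filter fun B => B ∈ targets) N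
    (fun p _ => hN p) γ (by
      intro h hh s t hs hP hT
      simp only [Finset.mem_filter, Finset.mem_univ, true_and] at hP hT
      -- For `s = 0`, a polymatroid that is flat on all constrained pairs but positive on the
      -- targets could be scaled beyond `γ`; for `s > 0`, rescale by `s⁻¹`.
      rcases hs.eq_or_lt with rfl | hs
      · rw [zero_mul]
        by_contra! ht
        have := hfeas _ (hh.const_mul (r := (γ + 1) / t) (by positivity)) (fun p hp => by
          have h1 := hP p hp
          rw [zero_mul] at h1
          have h2 : cond (fun Z => (γ + 1) / t * h Z) p = (γ + 1) / t * cond h p := by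
            simp only [ShannonFlow.cond]; ring
          rw [h2]
          exact (mul_nonpos_of_nonneg_of_nonpos (by positivity) h1).trans (hN p))
          ((γ + 1) / t * t) (fun B hB => mul_le_mul_of_nonneg_left (hT B hB) (by positivity))
        rw [div_mul_cancel₀ _ ht.ne'] at this
        linarith
      · have := hfeas _ (hh.const_mul (r := s⁻¹) (by positivity)) (fun p hp => by
          have h2 : cond (fun Z => s⁻¹ * h Z) p = s⁻¹ * cond h p := by
            simp only [ShannonFlow.cond]; ring
          rw [h2, inv_mul_le_iff₀ hs]
          exact hP p hp)
          (s⁻¹ * t) (fun B hB => mul_le_mul_of_nonneg_left (hT B hB) (by positivity))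
        rwa [inv_mul_le_iff₀ hs] at this)
  simp only [Finset.mem_filter, Finset.mem_univ, true_and] at hδP hlamT
  -- `D₁` cleared the denominators of the flow; `D₂` clears those of a minimal witness. The final
  -- vectors are divided by `D₁ * D₂`.
  obtain ⟨D₂, hD₂, hD₂le, z, hz⟩ := hx.exists_isMinWitness
  set δ₁ : Pair n → ℤ := (D₂ : ℤ) • δ with hδ₁
  set lam₁ : Finset (Fin n) → ℤ := (D₂ : ℤ) • lam with hlam₁
  have hδ₁0 : 0 ≤ δ₁ := smul_nonneg (by positivity) hδ
  have hlam₁0 : 0 ≤ lam₁ := smul_nonneg (by positivity) hlam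
  have hlam₁e : lam₁ ∅ = 0 := by simp [hlam₁, hlamT ∅ hempty]
  have hsum₁ : ∑ Z, lam₁ Z = (D₁ * D₂ : ℕ) := by
    simp only [hlam₁, Pi.smul_apply, smul_eq_mul, ← Finset.mul_sum, hsum]
    push_cast
    ring
  have hD : 0 < D₁ * D₂ := Nat.mul_pos hD₁ hD₂
  set D := D₁ * D₂ with hDdef
  obtain ⟨δ', l, hδ', hreach, hl⟩ := exists_reaches hδ₁0 hlam₁0 hlam₁e hz
  have hDq : (0 : ℚ) < D := by exact_mod_cast hD
  obtain ⟨steps, hlen, hspos, hsnn, hsfin⟩ := hreach.exists_steps hDq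
  let delta : Pair n → ℚ≥0 := fun p => ((δ₁ p).toNat : ℚ≥0) / D
  let lamF : Pair n → ℚ≥0 := fun p => ((emptyLower lam₁ p).toNat : ℚ≥0) / D
  have htoNat : ∀ a : ℤ, 0 ≤ a → ((a.toNat : ℕ) : ℝ) = a := fun a ha => by
    exact_mod_cast congrArg (Int.cast : ℤ → ℝ) (Int.toNat_of_nonneg ha)
  have htoNatQ : ∀ a : ℤ, 0 ≤ a → ((a.toNat : ℕ) : ℚ) = a := fun a ha => by
    exact_mod_cast congrArg (Int.cast : ℤ → ℚ) (Int.toNat_of_nonneg ha)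
  have hdelta : ∀ p, (delta p : ℝ) = δ₁ p / D := fun p => by
    simp only [delta]
    push_cast
    rw [htoNat _ (hδ₁0 p)]
  have hlamF : ∀ p, (lamF p : ℝ) = emptyLower lam₁ p / D := fun p => by
    simp only [lamF]
    push_cast
    rw [htoNat _ (emptyLower_nonneg hlam₁0 p)]
  have hdeltaQ : ∀ p, (delta p : ℚ) = δ₁ p / D := fun p => by
    simp only [delta]
    push_cast
    rw [htoNatQ _ (hδ₁0 p)]
  have hlamFQ : ∀ p, (lamF p : ℚ) = emptyLower lam₁ p / D := fun p => by
    simp only [lamF]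
    push_cast
    rw [htoNatQ _ (emptyLower_nonneg hlam₁0 p)]
  have hDR : (0 : ℝ) < D := by exact_mod_cast hD
  refine ⟨lamF, delta, ⟨fun p hp => by simp [lamF, emptyLower, hp], fun h hh => ?_⟩, ?_, ?_, ?_,
    steps, ⟨hspos, ?_, ?_⟩, ?_⟩
  · have h1 := hz.1.balance_nonneg hh
    rw [balance_eq, ← flowValue_emptyLower h hh.empty] at h1
    have e1 : pairing lamF h = flowValue (emptyLower lam₁) h / D := by
      simp only [pairing, flowValue, hlamF, Finset.sum_div]
      exact Finset.sum_congr rfl fun p _ => by ring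
    have e2 : pairing delta h = flowValue δ₁ h / D := by
      simp only [pairing, flowValue, hdelta, Finset.sum_div]
      exact Finset.sum_congr rfl fun p _ => by ring
    rw [e1, e2]
    exact div_le_div_of_nonneg_right (by linarith) hDR.le
  · have h1 : ((∑ p, lamF p : ℚ≥0) : ℝ) = 1 := by
      push_cast
      simp only [hlamF, ← Finset.sum_div]
      rw [div_eq_one_iff_eq hDR.ne']
      exact_mod_cast (sum_emptyLower hlam₁e).trans hsum₁
    exact_mod_cast h1
  -- Where the bound is `⊤`, `N p` is the default value 0 of `toReal`; the two sides agree because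
  -- `δ₁ p = 0` there.
  · have hterm : ∀ p, ((delta p : ℝ) : EReal) * logDegree DC p =
        ((δ₁ p / D * N p : ℝ) : EReal) := fun p => by
      rw [hdelta]
      by_cases hp : logDegree DC p < ⊤
      · rw [EReal.coe_mul, hNcoe p hp]
      · have : δ₁ p = 0 := by simp [hδ₁, hδP p hp]
        simp [this]
    rw [Finset.sum_congr rfl fun p _ => hterm p, hγ]
    have hs : ∀ s : Finset (Pair n), ∑ p ∈ s, ((δ₁ p / D * N p : ℝ) : EReal) =
        ((∑ p ∈ s, δ₁ p / D * N p : ℝ) : EReal) := fun s => by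
      induction s using Finset.induction_on with
      | empty => simp
      | insert a s ha ih => rw [Finset.sum_insert ha, Finset.sum_insert ha, ih, EReal.coe_add]
    rw [hs, EReal.coe_le_coe_iff]
    have e : ∑ p, (δ₁ p : ℝ) / D * N p = (∑ p, (δ p : ℝ) * N p) / D₁ := by
      rw [Finset.sum_div]
      refine Finset.sum_congr rfl fun p _ => ?_
      have h1 : (D₁ : ℝ) ≠ 0 := by exact_mod_cast hD₁.ne'
      have h2 : (D₂ : ℝ) ≠ 0 := by exact_mod_cast hD₂.ne'
      simp only [hδ₁, hDdef, Pi.smul_apply, smul_eq_mul]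
      push_cast
      field_simp
    rw [e, div_le_iff₀ (by exact_mod_cast hD₁)]
    linarith
  · rintro p (hp | hp)
    · simp [lamF, emptyLower, hp]
    · simp [lamF, emptyLower, hlam₁, hlamT _ hp]
  · intro i hi p
    rw [applySteps, hdeltaQ]
    exact hsnn i hi p
  · intro p
    rw [applySteps, hdeltaQ, hsfin, hlamFQ]
    refine div_le_div_of_nonneg_right ?_ hDq.le
    have := hδ' p
    simp only [Pi.zero_apply] at this
    rw [Pi.add_apply]
    exact_mod_cast le_add_of_nonneg_left this
  · rw [hlen]
    have hw := hz.submodWeight_le hδ₁0 hlam₁0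
    rw [hsum₁] at hw hl
    refine length_bound hD ?_ ?_ (by exact_mod_cast hw) (by exact_mod_cast hl)
    · rw [two_mul, pow_add]
      exact Nat.mul_le_mul hD₁le hD₂le
    · refine Finset.sum_nonneg fun q _ => ?_
      have : (0 : ℝ) ≤ z (Sum.inl q) := hz.1.1 _
      exact_mod_cast this
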